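/- For a Riemannian metric $g$ on a smooth $4$-manifold $M$ and a $2$-plane $\sigma\subset T_pM$, let $\sigma^\perp\subset T_pM$ be the $g$-orthogonal complement of $\sigma$, and define the biorthogonal curvature of $\sigma$ as $$\sec_g^\perp(\sigma):=\tfrac12\big(\sec_g(\sigma)+\sec_g(\sigma^\perp)\big),$$ where $\sec_g$ is the sectional curvature. **Proposition.** Let $\overline{\mathbb{CP}}^2$ denote the complex projective plane $\mathbb{CP}^2$ with the orientation opposite to the one induced by its complex structure. The smooth manifold $\mathbb{CP}^2\#\overline{\mathbb{CP}}^2$ admits a smooth Riemannian metric $g$ of positive biorthogonal curvature, that is, such that $\sec_g^\perp(\sigma)>0$ for every point $p$ and every $2$-plane $\sigma\subset T_p(\mathbb{CP}^2\#\overline{\mathbb{CP}}^2)$. -/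

import Mathlib

open scoped Manifold ContDiff Topology LinearAlgebra.Projectivization

noncomputable section

/-! ### Complex projective space as a smooth (real) manifold -/

/-- Complex projective space `ℂPⁿ`: the set of complex lines through the origin of `ℂⁿ⁺¹`. -/
def CP (n : ℕ) : Type := ℙ ℂ (Fin (n + 1) → ℂ)

namespace CP

variable {n : ℕ}

/-- The line spanned by a nonzero vector. -/
def mk (u : Fin (n + 1) → ℂ) (hu : u ≠ 0) : CP n := Projectivization.mk ℂ u hu

/-- Homogeneous coordinates of a line (some nonzero vector on it). -/
def rep (L : CP n) : Fin (n + 1) → ℂ := Projectivization.rep L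

lemma rep_ne_zero (L : CP n) : L.rep ≠ 0 := Projectivization.rep_nonzero L

lemma mk_rep (L : CP n) : mk L.rep L.rep_ne_zero = L := Projectivization.mk_rep L

lemma exists_rep_mk (u : Fin (n + 1) → ℂ) (hu : u ≠ 0) :
    ∃ a : ℂ, a ≠ 0 ∧ ∀ k, (mk u hu).rep k = a * u k := by
  obtain ⟨a, ha⟩ := Projectivization.exists_smul_eq_mk_rep ℂ u hu
  exact ⟨a, a.ne_zero, fun k => (congrFun ha k).symm⟩

lemma mk_eq_mk_of {u w : Fin (n + 1) → ℂ} (hu : u ≠ 0) (hw : w ≠ 0) (a : ℂ)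
    (h : ∀ k, a * w k = u k) : mk u hu = mk w hw :=
  (Projectivization.mk_eq_mk_iff' ℂ u w hu hw).2 ⟨a, funext h⟩

/-- The vector `(v₁, …, 1, …, vₙ)` with the entry `1` in position `i`. -/
def homog (i : Fin (n + 1)) (v : EuclideanSpace ℂ (Fin n)) : Fin (n + 1) → ℂ :=
  i.insertNth (α := fun _ => ℂ) 1 (fun k => v k)

@[simp] lemma homog_self (i : Fin (n + 1)) (v : EuclideanSpace ℂ (Fin n)) :
    homog i v i = 1 := by simp [homog]

@[simp] lemma homog_succAbove (i : Fin (n + 1)) (v : EuclideanSpace ℂ (Fin n)) (k : Fin n) :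
    homog i v (i.succAbove k) = v k := by simp [homog]

lemma homog_ne_zero (i : Fin (n + 1)) (v : EuclideanSpace ℂ (Fin n)) : homog i v ≠ 0 :=
  fun h => one_ne_zero ((homog_self i v).symm.trans (congrFun h i))

lemma contDiff_homog (i j : Fin (n + 1)) :
    ContDiff ℝ ∞ (fun v : EuclideanSpace ℂ (Fin n) => homog i v j) := by
  induction j using Fin.succAboveCases i with
  | x => simpa using contDiff_const
  | p k =>
    simp only [homog_succAbove]
    fun_prop

/-- The `i`-th affine chart `[z₀ : … : zₙ] ↦ (z₀ / zᵢ, …, zₙ / zᵢ)` (omitting `zᵢ / zᵢ`), defined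
where `zᵢ ≠ 0`. -/
def affinePartialEquiv (i : Fin (n + 1)) : PartialEquiv (CP n) (EuclideanSpace ℂ (Fin n)) where
  toFun L := WithLp.toLp 2 fun k => L.rep (i.succAbove k) / L.rep i
  invFun v := mk (homog i v) (homog_ne_zero i v)
  source := {L | L.rep i ≠ 0}
  target := Set.univ
  map_source' _ _ := Set.mem_univ _
  map_target' v _ := by
    obtain ⟨a, ha, h⟩ := exists_rep_mk (homog i v) (homog_ne_zero i v)
    simpa [h] using ha
  left_inv' L hL := by
    have hL' : L.rep i ≠ 0 := hL
    conv_rhs => rw [← L.mk_rep]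
    refine mk_eq_mk_of _ _ (L.rep i)⁻¹ fun k => ?_
    induction k using Fin.succAboveCases i with
    | x => simp [hL']
    | p k => simp [div_eq_inv_mul]
  right_inv' v _ := by
    obtain ⟨a, ha, h⟩ := exists_rep_mk (homog i v) (homog_ne_zero i v)
    ext k
    simp [h, ha]

lemma affine_trans_apply (i j : Fin (n + 1)) (v : EuclideanSpace ℂ (Fin n)) :
    (affinePartialEquiv i).symm.trans (affinePartialEquiv j) v =
      WithLp.toLp 2 fun k => homog i v (j.succAbove k) / homog i v j := by
  obtain ⟨a, ha, h⟩ := exists_rep_mk (homog i v) (homog_ne_zero i v)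
  ext k
  simp [affinePartialEquiv, h, mul_div_mul_left _ _ ha]

lemma affine_trans_source (i j : Fin (n + 1)) :
    ((affinePartialEquiv i).symm.trans (affinePartialEquiv j)).source =
      {v : EuclideanSpace ℂ (Fin n) | homog i v j ≠ 0} := by
  ext v
  obtain ⟨a, ha, h⟩ := exists_rep_mk (homog i v) (homog_ne_zero i v)
  simp [PartialEquiv.trans_source, affinePartialEquiv, h, ha]

lemma affine_trans_contDiffOn (i j : Fin (n + 1)) :
    ContDiffOn ℝ ∞ ((affinePartialEquiv i).symm.trans (affinePartialEquiv j))
      ((affinePartialEquiv i).symm.trans (affinePartialEquiv j)).source := by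
  rw [affine_trans_source, funext (affine_trans_apply i j), contDiffOn_piLp]
  intro k
  simp only [div_eq_mul_inv]
  exact (contDiff_homog i _).contDiffOn.mul
    ((contDiff_homog i j).contDiffOn.inv fun v hv => hv)

lemma exists_rep_apply_ne_zero (L : CP n) : ∃ i, L.rep i ≠ 0 :=
  Function.ne_iff.1 L.rep_ne_zero

/-- The topology and the smooth structure of `ℂPⁿ` are those given by the affine charts. -/
def core (n : ℕ) : ChartedSpaceCore (EuclideanSpace ℂ (Fin n)) (CP n) where
  atlas := Set.range affinePartialEquiv
  chartAt L := affinePartialEquiv L.exists_rep_apply_ne_zero.choose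
  mem_chart_source L := L.exists_rep_apply_ne_zero.choose_spec
  chart_mem_atlas _ := Set.mem_range_self _
  open_source := by
    rintro _ _ ⟨i, rfl⟩ ⟨j, rfl⟩
    rw [affine_trans_source]
    exact isOpen_ne_fun (contDiff_homog i j).continuous continuous_const
  continuousOn_toFun := by
    rintro _ _ ⟨i, rfl⟩ ⟨j, rfl⟩
    exact (affine_trans_contDiffOn i j).continuousOn

instance : TopologicalSpace (CP n) := (core n).toTopologicalSpace

instance : ChartedSpace (EuclideanSpace ℂ (Fin n)) (CP n) := (core n).toChartedSpace

/-- The `i`-th affine chart, as an open partial homeomorphism. -/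
def affineChart (i : Fin (n + 1)) : OpenPartialHomeomorph (CP n) (EuclideanSpace ℂ (Fin n)) :=
  (core n).openPartialHomeomorph (affinePartialEquiv i) ⟨i, rfl⟩

lemma mem_atlas_iff {e : OpenPartialHomeomorph (CP n) (EuclideanSpace ℂ (Fin n))} :
    e ∈ atlas (EuclideanSpace ℂ (Fin n)) (CP n) ↔ ∃ i, e = affineChart i := by
  constructor
  · intro he
    obtain ⟨_, ⟨e₀, rfl⟩, _, ⟨⟨i, rfl⟩, rfl⟩, he⟩ := he
    exact ⟨i, he⟩
  · rintro ⟨i, rfl⟩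
    exact Set.mem_iUnion₂.2 ⟨affinePartialEquiv i, ⟨i, rfl⟩, rfl⟩

instance : IsManifold 𝓘(ℝ, EuclideanSpace ℂ (Fin n)) ∞ (CP n) := by
  apply isManifold_of_contDiffOn
  intro e e' he he'
  obtain ⟨i, rfl⟩ := mem_atlas_iff.1 he
  obtain ⟨j, rfl⟩ := mem_atlas_iff.1 he'
  simp only [modelWithCornersSelf_coe, modelWithCornersSelf_coe_symm, Set.range_id,
    Set.inter_univ, Set.preimage_id_eq, id_eq, Function.id_comp, Function.comp_id]
  exact affine_trans_contDiffOn i j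

/-- The matrix of the orthogonal projection to a line, used to see that `ℂPⁿ` is Hausdorff. -/
def projMatrix (u : Fin (n + 1) → ℂ) (a b : Fin (n + 1)) : ℂ :=
  u a * star (u b) / ∑ k, u k * star (u k)

lemma sum_mul_star_ne_zero {u : Fin (n + 1) → ℂ} (hu : u ≠ 0) : ∑ k, u k * star (u k) ≠ 0 := by
  open scoped ComplexOrder in
  exact fun h => hu (dotProduct_self_star_eq_zero.1 h)

lemma projMatrix_mul {u w : Fin (n + 1) → ℂ} {c : ℂ} (hc : c ≠ 0) (h : ∀ k, w k = c * u k) :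
    projMatrix w = projMatrix u := by
  have hc' : c * star c ≠ 0 := mul_ne_zero hc (star_ne_zero.2 hc)
  funext a b
  have : ∀ a b, w a * star (w b) = (c * star c) * (u a * star (u b)) := by
    intro a b
    rw [h, h, star_mul']
    ring
  simp only [projMatrix, this, ← Finset.mul_sum]
  exact mul_div_mul_left _ _ hc'

instance : T2Space (CP n) := by
  refine T2Space.of_injective_continuous (f := fun L : CP n => projMatrix L.rep) ?_ ?_
  · intro L L' h
    have hs := sum_mul_star_ne_zero L.rep_ne_zero
    have hs' := sum_mul_star_ne_zero L'.rep_ne_zero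
    obtain ⟨b, hb⟩ := L.exists_rep_apply_ne_zero
    have hb' := star_ne_zero.2 hb
    rw [← L.mk_rep, ← L'.mk_rep]
    refine mk_eq_mk_of _ _
      (star (L'.rep b) / (∑ k, L'.rep k * star (L'.rep k)) *
        ((∑ k, L.rep k * star (L.rep k)) / star (L.rep b))) fun a => ?_
    have hab := congrFun (congrFun h a) b
    simp only [projMatrix] at hab
    calc _ = L'.rep a * star (L'.rep b) / (∑ k, L'.rep k * star (L'.rep k)) *
        ((∑ k, L.rep k * star (L.rep k)) / star (L.rep b)) := by ring
      _ = _ := by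
        rw [← hab]
        field_simp
  · rw [continuous_iff_continuousAt]
    intro L
    obtain ⟨i, hi⟩ := L.exists_rep_apply_ne_zero
    have hL : (affineChart i).source ∈ 𝓝 L := (affineChart i).open_source.mem_nhds hi
    have hhom : Continuous fun v : EuclideanSpace ℂ (Fin n) => homog i v :=
      continuous_pi fun j => (contDiff_homog i j).continuous
    have hcont : Continuous fun v : EuclideanSpace ℂ (Fin n) => projMatrix (homog i v) := by
      refine continuous_pi fun a => continuous_pi fun b => ?_
      unfold projMatrix
      refine Continuous.div (by fun_prop) (by fun_prop)
        fun v => sum_mul_star_ne_zero (homog_ne_zero i v)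
    have := hcont.continuousAt.comp ((affineChart i).continuousAt hi)
    refine this.congr (Filter.eventuallyEq_of_mem hL fun L' hL' => ?_)
    have hL'' : L'.rep i ≠ 0 := hL'
    refine projMatrix_mul (inv_ne_zero hL'') fun k => ?_
    change homog i (affinePartialEquiv i L') k = _
    induction k using Fin.succAboveCases i with
    | x => simp [hL'']
    | p k => simp [affinePartialEquiv, div_eq_inv_mul]

end CP

/-! ### Connected sums -/

/-- A disk in a smooth manifold `M`: an open smooth embedding `chart.symm : E → M` of the whole
model space, given through its inverse, a chart of `M` that is onto `E`. -/
structure Disk (E : Type*) [NormedAddCommGroup E] [NormedSpace ℝ E]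
    (M : Type*) [TopologicalSpace M] [ChartedSpace E M] where
  chart : OpenPartialHomeomorph M E
  mem_maximalAtlas : chart ∈ IsManifold.maximalAtlas 𝓘(ℝ, E) ∞ M
  target_eq : chart.target = Set.univ

/-- The inversion `v ↦ v / ‖v‖²` of `E \ {0}` in the unit sphere; it reverses both the radial
direction and the orientation. -/
def inversion {E : Type*} [NormedAddCommGroup E] [NormedSpace ℝ E] (v : E) : E :=
  (‖v‖ ^ 2)⁻¹ • v

lemma inversion_ne_zero {E : Type*} [NormedAddCommGroup E] [NormedSpace ℝ E] {v : E}
    (hv : v ≠ 0) : inversion v ≠ 0 :=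
  smul_ne_zero (inv_ne_zero (pow_ne_zero 2 (norm_ne_zero_iff.2 hv))) hv

lemma inversion_inversion {E : Type*} [NormedAddCommGroup E] [NormedSpace ℝ E] (v : E) :
    inversion (inversion v) = v := by
  by_cases hv : v = 0
  · simp [inversion, hv]
  have h : ‖v‖ ≠ 0 := norm_ne_zero_iff.2 hv
  simp only [inversion, norm_smul, smul_smul, norm_inv, norm_pow, norm_norm]
  rw [show ((((‖v‖ ^ 2)⁻¹ * ‖v‖) ^ 2)⁻¹ * (‖v‖ ^ 2)⁻¹ : ℝ) = 1 by field_simp, one_smul]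

lemma contDiffOn_inversion {E : Type*} [NormedAddCommGroup E] [InnerProductSpace ℝ E] :
    ContDiffOn ℝ ∞ (inversion : E → E) {0}ᶜ := by
  refine ContDiffOn.smul (ContDiffOn.inv (contDiff_norm_sq ℝ).contDiffOn fun v hv => ?_)
    contDiffOn_id
  exact pow_ne_zero 2 (norm_ne_zero_iff.2 hv)

lemma continuousOn_inversion {E : Type*} [NormedAddCommGroup E] [InnerProductSpace ℝ E] :
    ContinuousOn (inversion : E → E) {0}ᶜ := contDiffOn_inversion.continuousOn

namespace Disk

variable {E : Type*} [NormedAddCommGroup E] [NormedSpace ℝ E]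
  {M : Type*} [TopologicalSpace M] [ChartedSpace E M]

/-- The center of a disk. -/
def center (φ : Disk E M) : M := φ.chart.symm 0

/-- The manifold with the center of the disk removed. -/
def punctured [T2Space M] (φ : Disk E M) : TopologicalSpace.Opens M :=
  ⟨{φ.center}ᶜ, isOpen_compl_singleton⟩

lemma mem_target (φ : Disk E M) (v : E) : v ∈ φ.chart.target := φ.target_eq ▸ Set.mem_univ v

lemma chart_symm (φ : Disk E M) (v : E) : φ.chart (φ.chart.symm v) = v :=
  φ.chart.right_inv (φ.mem_target v)

lemma symm_mem_source (φ : Disk E M) (v : E) : φ.chart.symm v ∈ φ.chart.source :=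
  φ.chart.map_target (φ.mem_target v)

lemma chart_ne_zero [T2Space M] (φ : Disk E M) (x : φ.punctured) (hx : (x : M) ∈ φ.chart.source) :
    φ.chart x ≠ 0 := by
  intro h
  apply x.2
  rw [Set.mem_singleton_iff, center, ← h, φ.chart.left_inv hx]

lemma symm_mem_punctured [T2Space M] (φ : Disk E M) {v : E} (hv : v ≠ 0) :
    φ.chart.symm v ∈ φ.punctured := by
  intro h
  apply hv
  rw [← φ.chart_symm v, Set.mem_singleton_iff.1 h, center, φ.chart_symm]

end Disk

section ConnectedSum

variable {E : Type*} [NormedAddCommGroup E] [InnerProductSpace ℝ E]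
  {M₁ : Type*} [TopologicalSpace M₁] [ChartedSpace E M₁] [T2Space M₁]
  {M₂ : Type*} [TopologicalSpace M₂] [ChartedSpace E M₂] [T2Space M₂]

/-- `x` and `y` are glued if `x = φ₁⁻¹(v)` and `y = φ₂⁻¹(v / ‖v‖²)` for some `v ≠ 0`. -/
def Glued (φ₁ : Disk E M₁) (φ₂ : Disk E M₂) (x : φ₁.punctured) (y : φ₂.punctured) : Prop :=
  ∃ v : E, v ≠ 0 ∧ (x : M₁) = φ₁.chart.symm v ∧ (y : M₂) = φ₂.chart.symm (inversion v)

lemma Glued.swap {φ₁ : Disk E M₁} {φ₂ : Disk E M₂} {x : φ₁.punctured} {y : φ₂.punctured}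
    (h : Glued φ₁ φ₂ x y) : Glued φ₂ φ₁ y x := by
  obtain ⟨v, hv, hx, hy⟩ := h
  exact ⟨inversion v, inversion_ne_zero hv, hy, by rw [inversion_inversion, hx]⟩

lemma Glued.eq_right {φ₁ : Disk E M₁} {φ₂ : Disk E M₂} {x : φ₁.punctured} {y y' : φ₂.punctured}
    (h : Glued φ₁ φ₂ x y) (h' : Glued φ₁ φ₂ x y') : y = y' := by
  obtain ⟨v, hv, hx, hy⟩ := h
  obtain ⟨v', hv', hx', hy'⟩ := h'
  have : v = v' := by rw [← φ₁.chart_symm v, ← hx, hx', φ₁.chart_symm]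
  apply Subtype.ext
  rw [hy, hy', this]

lemma Glued.eq_left {φ₁ : Disk E M₁} {φ₂ : Disk E M₂} {x x' : φ₁.punctured} {y : φ₂.punctured}
    (h : Glued φ₁ φ₂ x y) (h' : Glued φ₁ φ₂ x' y) : x = x' :=
  h.swap.eq_right h'.swap

lemma Glued.source_left {φ₁ : Disk E M₁} {φ₂ : Disk E M₂} {x : φ₁.punctured} {y : φ₂.punctured}
    (h : Glued φ₁ φ₂ x y) : (x : M₁) ∈ φ₁.chart.source := by
  obtain ⟨v, hv, hx, hy⟩ := h
  exact hx ▸ φ₁.symm_mem_source v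

lemma Glued.coe_right {φ₁ : Disk E M₁} {φ₂ : Disk E M₂} {x : φ₁.punctured} {y : φ₂.punctured}
    (h : Glued φ₁ φ₂ x y) : (y : M₂) = φ₂.chart.symm (inversion (φ₁.chart x)) := by
  obtain ⟨v, hv, hx, hy⟩ := h
  rw [hx, φ₁.chart_symm, hy]

/-- The points that are glued to a point of an open set form an open set. -/
lemma isOpen_glued (φ₁ : Disk E M₁) (φ₂ : Disk E M₂) {U : Set φ₁.punctured} (hU : IsOpen U) :
    IsOpen {y : φ₂.punctured | ∃ x ∈ U, Glued φ₁ φ₂ x y} := by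
  have hU' : IsOpen ((↑) '' U : Set M₁) := φ₁.punctured.isOpen.isOpenMap_subtype_val U hU
  have h1 : IsOpen (φ₁.chart.symm ⁻¹' ((↑) '' U)) := by
    have := φ₁.chart.symm.isOpen_inter_preimage hU'
    rwa [φ₁.chart.symm_source, φ₁.target_eq, Set.univ_inter] at this
  have h2 : IsOpen ({0}ᶜ ∩ inversion ⁻¹' (φ₁.chart.symm ⁻¹' ((↑) '' U))) :=
    continuousOn_inversion.isOpen_inter_preimage isOpen_compl_singleton h1
  have h3 := (φ₂.chart.isOpen_inter_preimage h2).preimage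
    (continuous_subtype_val (p := (· ∈ φ₂.punctured)))
  convert! h3 using 1
  ext y
  constructor
  · rintro ⟨x, hx, hxy⟩
    have h := hxy.swap
    refine ⟨h.source_left, φ₂.chart_ne_zero y h.source_left, x, hx, h.coe_right⟩
  · rintro ⟨hy, hy0, x, hx, hxy⟩
    refine ⟨x, hx, Glued.swap ⟨φ₂.chart y, hy0, (φ₂.chart.left_inv hy).symm, hxy⟩⟩

/-- The equivalence relation that identifies each pair of glued points. -/
def glueSetoid (φ₁ : Disk E M₁) (φ₂ : Disk E M₂) : Setoid (φ₁.punctured ⊕ φ₂.punctured) where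
  r
    | .inl x, .inl x' => x = x'
    | .inl x, .inr y => Glued φ₁ φ₂ x y
    | .inr y, .inl x => Glued φ₁ φ₂ x y
    | .inr y, .inr y' => y = y'
  iseqv :=
    { refl := by rintro (x | y) <;> rfl
      symm := by rintro (x | y) (x' | y') h <;> first | exact h | exact h.symm
      trans := by
        rintro (x | y) (x' | y') (x'' | y'') h h'
        · exact h.trans h'
        · exact (show x = x' from h) ▸ h'
        · exact Glued.eq_left h h'
        · exact (show y' = y'' from h') ▸ h
        · exact (show x' = x'' from h') ▸ h
        · exact Glued.eq_right h h'
        · exact (show y = y' from h) ▸ h'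
        · exact h.trans h' }

/-- The connected sum of two smooth manifolds along two disks: the centers of the disks are
removed, and the punctured disks are identified through the inversion `v ↦ v / ‖v‖²`.

For oriented manifolds of the same dimension this is the oriented connected sum `M₁ # M₂` when the
embedding `φ₁⁻¹ : E → M₁` preserves and `φ₂⁻¹ : E → M₂` reverses the orientation: the gluing map
then preserves the orientation. -/
def ConnectedSum (φ₁ : Disk E M₁) (φ₂ : Disk E M₂) : Type _ := Quotient (glueSetoid φ₁ φ₂)

namespace ConnectedSum

variable (φ₁ : Disk E M₁) (φ₂ : Disk E M₂)

instance : TopologicalSpace (ConnectedSum φ₁ φ₂) :=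
  inferInstanceAs (TopologicalSpace (Quotient (glueSetoid φ₁ φ₂)))

/-- The inclusion of the first punctured manifold. -/
def inl (x : φ₁.punctured) : ConnectedSum φ₁ φ₂ := Quotient.mk (glueSetoid φ₁ φ₂) (.inl x)

/-- The inclusion of the second punctured manifold. -/
def inr (y : φ₂.punctured) : ConnectedSum φ₁ φ₂ := Quotient.mk (glueSetoid φ₁ φ₂) (.inr y)

variable {φ₁ φ₂}

lemma inl_eq_inl {x x' : φ₁.punctured} : inl φ₁ φ₂ x = inl φ₁ φ₂ x' ↔ x = x' := Quotient.eq

lemma inr_eq_inr {y y' : φ₂.punctured} : inr φ₁ φ₂ y = inr φ₁ φ₂ y' ↔ y = y' := Quotient.eq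

lemma inl_eq_inr {x : φ₁.punctured} {y : φ₂.punctured} :
    inl φ₁ φ₂ x = inr φ₁ φ₂ y ↔ Glued φ₁ φ₂ x y := Quotient.eq

lemma isOpen_iff {U : Set (ConnectedSum φ₁ φ₂)} :
    IsOpen U ↔ IsOpen (inl φ₁ φ₂ ⁻¹' U) ∧ IsOpen (inr φ₁ φ₂ ⁻¹' U) := by
  have h : IsOpen U ↔ IsOpen (Quotient.mk (glueSetoid φ₁ φ₂) ⁻¹' U) := Iff.rfl
  rw [h, isOpen_sum_iff]
  rfl

lemma continuous_inl : Continuous (inl φ₁ φ₂) := ⟨fun _ hU => (isOpen_iff.1 hU).1⟩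

lemma continuous_inr : Continuous (inr φ₁ φ₂) := ⟨fun _ hU => (isOpen_iff.1 hU).2⟩

lemma isOpenEmbedding_inl : Topology.IsOpenEmbedding (inl φ₁ φ₂) := by
  refine .of_continuous_injective_isOpenMap continuous_inl (fun _ _ => inl_eq_inl.1) fun U hU =>
    isOpen_iff.2 ⟨?_, ?_⟩
  · rwa [Set.preimage_image_eq _ fun _ _ => inl_eq_inl.1]
  · convert! isOpen_glued φ₁ φ₂ hU using 1
    ext y
    simp [inl_eq_inr]

lemma isOpenEmbedding_inr : Topology.IsOpenEmbedding (inr φ₁ φ₂) := by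
  refine .of_continuous_injective_isOpenMap continuous_inr (fun _ _ => inr_eq_inr.1) fun U hU =>
    isOpen_iff.2 ⟨?_, ?_⟩
  · convert! isOpen_glued φ₂ φ₁ hU using 1
    ext x
    simp only [Set.mem_preimage, Set.mem_image, eq_comm (b := inl φ₁ φ₂ x), inl_eq_inr]
    exact exists_congr fun y => and_congr_right fun _ => ⟨Glued.swap, Glued.swap⟩
  · rwa [Set.preimage_image_eq _ fun _ _ => inr_eq_inr.1]

lemma exists_inl_or_inr (c : ConnectedSum φ₁ φ₂) :
    (∃ x, inl φ₁ φ₂ x = c) ∨ ∃ y, inr φ₁ φ₂ y = c := by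
  obtain ⟨x | y, rfl⟩ := Quotient.exists_rep c
  · exact .inl ⟨x, rfl⟩
  · exact .inr ⟨y, rfl⟩

/-- A chart of the first punctured manifold, as a chart of the connected sum. -/
def liftl (e : OpenPartialHomeomorph φ₁.punctured E) :
    OpenPartialHomeomorph (ConnectedSum φ₁ φ₂) E :=
  e.lift_openEmbedding isOpenEmbedding_inl

/-- A chart of the second punctured manifold, as a chart of the connected sum. -/
def liftr (e : OpenPartialHomeomorph φ₂.punctured E) :
    OpenPartialHomeomorph (ConnectedSum φ₁ φ₂) E :=
  e.lift_openEmbedding isOpenEmbedding_inr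

lemma exists_chart (c : ConnectedSum φ₁ φ₂) :
    ∃ e ∈ (liftl '' atlas E φ₁.punctured ∪ liftr '' atlas E φ₂.punctured :
      Set (OpenPartialHomeomorph (ConnectedSum φ₁ φ₂) E)), c ∈ e.source := by
  obtain ⟨x, rfl⟩ | ⟨y, rfl⟩ := exists_inl_or_inr c
  · exact ⟨liftl (chartAt E x), .inl ⟨_, chart_mem_atlas E x, rfl⟩,
      Set.mem_image_of_mem _ (mem_chart_source E x)⟩
  · exact ⟨liftr (chartAt E y), .inr ⟨_, chart_mem_atlas E y, rfl⟩,
      Set.mem_image_of_mem _ (mem_chart_source E y)⟩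

/-- The atlas of the connected sum consists of the charts of both punctured manifolds. -/
instance : ChartedSpace E (ConnectedSum φ₁ φ₂) where
  atlas := liftl '' atlas E φ₁.punctured ∪ liftr '' atlas E φ₂.punctured
  chartAt c := (exists_chart c).choose
  mem_chart_source c := (exists_chart c).choose_spec.2
  chart_mem_atlas c := (exists_chart c).choose_spec.1

/-- The gluing map is smooth in charts. -/
lemma contDiffOn_glue [IsManifold 𝓘(ℝ, E) ∞ M₁] [IsManifold 𝓘(ℝ, E) ∞ M₂]
    {e : OpenPartialHomeomorph φ₁.punctured E} (he : e ∈ atlas E φ₁.punctured)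
    {e' : OpenPartialHomeomorph φ₂.punctured E} (he' : e' ∈ atlas E φ₂.punctured)
    {f : E → E} {s : Set E} (hs : s ⊆ e.target)
    (hf : ∀ v ∈ s, ∃ y ∈ e'.source, f v = e' y ∧ Glued φ₁ φ₂ (e.symm v) y) :
    ContDiffOn ℝ ∞ f s := by
  obtain ⟨x₀, rfl⟩ := Set.mem_iUnion.1 he
  obtain ⟨y₀, rfl⟩ := Set.mem_iUnion.1 he'
  set c₁ := chartAt E (x₀ : M₁)
  set c₂ := chartAt E (y₀ : M₂)
  have key : ∀ v ∈ s, v ∈ c₁.target ∧ c₁.symm v ∈ φ₁.chart.source ∧ φ₁.chart (c₁.symm v) ≠ 0 ∧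
      φ₂.chart.symm (inversion (φ₁.chart (c₁.symm v))) ∈ c₂.source ∧
      f v = c₂ (φ₂.chart.symm (inversion (φ₁.chart (c₁.symm v)))) := by
    intro v hv
    obtain ⟨y, hy, hfy, hg⟩ := hf v hv
    have hvt := hs hv
    have h1 : c₁.symm v = ((c₁.subtypeRestr ⟨x₀⟩).symm v : M₁) :=
      c₁.subtypeRestr_symm_eqOn ⟨x₀⟩ hvt
    rw [c₂.subtypeRestr_source] at hy
    rw [h1, ← hg.coe_right]
    refine ⟨?_, hg.source_left, φ₁.chart_ne_zero _ hg.source_left, hy, hfy⟩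
    exact hvt.1
  have hA : ContDiffOn ℝ ∞ (fun v => φ₁.chart (c₁.symm v)) s := by
    rw [← contMDiffOn_iff_contDiffOn]
    exact (contMDiffOn_of_mem_maximalAtlas φ₁.mem_maximalAtlas).comp
      ((contMDiffOn_chart_symm (I := 𝓘(ℝ, E)) (n := ∞)).mono fun v hv => (key v hv).1)
      fun v hv => (key v hv).2.1
  have hB := contDiffOn_inversion.comp hA fun v hv => (key v hv).2.2.1
  refine ContDiffOn.congr ?_ fun v hv => (key v hv).2.2.2.2
  rw [← contMDiffOn_iff_contDiffOn] at hB ⊢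
  exact (contMDiffOn_chart (I := 𝓘(ℝ, E)) (n := ∞)).comp
    ((contMDiffOn_symm_of_mem_maximalAtlas φ₂.mem_maximalAtlas).comp hB
      fun v _ => φ₂.mem_target _) fun v hv => (key v hv).2.2.2.1

instance [IsManifold 𝓘(ℝ, E) ∞ M₁] [IsManifold 𝓘(ℝ, E) ∞ M₂] :
    IsManifold 𝓘(ℝ, E) ∞ (ConnectedSum φ₁ φ₂) := by
  apply isManifold_of_contDiffOn
  intro e e' he he'
  simp only [modelWithCornersSelf_coe, modelWithCornersSelf_coe_symm, Set.range_id,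
    Set.inter_univ, Set.preimage_id_eq, id_eq, Function.id_comp, Function.comp_id]
  obtain ⟨e, he, rfl⟩ | ⟨e, he, rfl⟩ := he <;> obtain ⟨e', he', rfl⟩ | ⟨e', he', rfl⟩ := he'
  · rw [liftl, liftl, OpenPartialHomeomorph.lift_openEmbedding_trans]
    have := (contDiffGroupoid ∞ 𝓘(ℝ, E)).compatible he he'
    exact contMDiffOn_iff_contDiffOn.1 (contMDiffOn_of_mem_contDiffGroupoid this)
  · refine contDiffOn_glue he he' (fun v hv => hv.1) ?_
    rintro v ⟨hv, y, hy, hvy⟩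
    refine ⟨y, hy, ?_, inl_eq_inr.1 hvy.symm⟩
    change liftr e' (inl φ₁ φ₂ (e.symm v)) = e' y
    rw [show inl φ₁ φ₂ (e.symm v) = inr φ₁ φ₂ y from hvy.symm]
    exact e'.lift_openEmbedding_apply isOpenEmbedding_inr
  · refine contDiffOn_glue he he' (fun v hv => hv.1) ?_
    rintro v ⟨hv, y, hy, hvy⟩
    refine ⟨y, hy, ?_, (inl_eq_inr.1 hvy).swap⟩
    change liftl e' (inr φ₁ φ₂ (e.symm v)) = e' y
    rw [show inr φ₁ φ₂ (e.symm v) = inl φ₁ φ₂ y from hvy.symm]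
    exact e'.lift_openEmbedding_apply isOpenEmbedding_inl
  · rw [liftr, liftr, OpenPartialHomeomorph.lift_openEmbedding_trans]
    have := (contDiffGroupoid ∞ 𝓘(ℝ, E)).compatible he he'
    exact contMDiffOn_iff_contDiffOn.1 (contMDiffOn_of_mem_contDiffGroupoid this)

end ConnectedSum

end ConnectedSum

/-! ### The manifold `ℂP² # -ℂP²` -/

/-- The real model space of the complex projective plane, `ℂ²` with its Euclidean norm. -/
abbrev ModelC2 : Type := EuclideanSpace ℂ (Fin 2)

/-- The standard disk `ℂ² → ℂP²`, `v ↦ [1 : v₁ : v₂]`. -/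
def CP.standardDisk : Disk ModelC2 (CP 2) where
  chart := CP.affineChart 0
  mem_maximalAtlas := IsManifold.subset_maximalAtlas (CP.mem_atlas_iff.2 ⟨0, rfl⟩)
  target_eq := rfl

/-- The connected sum of `ℂP²` and `ℂP²` with the opposite orientation. The standard disk is
holomorphic, so that it preserves the orientation of `ℂP²` given by its complex structure and
reverses the opposite orientation: it may be used for both summands. -/
abbrev CP2SumCP2Bar : Type := ConnectedSum CP.standardDisk CP.standardDisk

/-! ### Curvature of a Riemannian metric -/

section LocalCurvature

variable {E : Type*} [NormedAddCommGroup E] [NormedSpace ℝ E]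

/-- The Christoffel symbol `Γ(v, w) = ∇_v w` (for constant vector fields `v`, `w`) at the point `y`
of the metric `G` on (an open subset of) `E`, given by
`2 G(Γ(v, w), u) = ∂_v G(w, u) + ∂_w G(v, u) - ∂_u G(v, w)`. -/
def christoffel (G : E → E →L[ℝ] E →L[ℝ] ℝ) (y v w : E) : E :=
  (G y).inverse ((1 / 2 : ℝ) •
    (fderiv ℝ G y v w + fderiv ℝ G y w v - ((fderiv ℝ G y).flip v).flip w))

/-- The Riemann curvature `R(u, v) w = ∇_u ∇_v w - ∇_v ∇_u w` (for constant vector fields `u`, `v`,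
`w`) at the point `y` of the metric `G`. -/
def localRiemann (G : E → E →L[ℝ] E →L[ℝ] ℝ) (y u v w : E) : E :=
  fderiv ℝ (fun z => christoffel G z v w) y u + christoffel G y u (christoffel G y v w) -
    (fderiv ℝ (fun z => christoffel G z u w) y v + christoffel G y v (christoffel G y u w))

/-- The sectional curvature `G(R(u, v) v, u) / (|u|² |v|² - G(u, v)²)` at the point `y` of the
metric `G`. -/
def localSec (G : E → E →L[ℝ] E →L[ℝ] ℝ) (y u v : E) : ℝ :=
  G y (localRiemann G y u v v) u / (G y u u * G y v v - G y u v ^ 2)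

end LocalCurvature

section Curvature

variable {E : Type*} [NormedAddCommGroup E] [NormedSpace ℝ E]
  {M : Type*} [TopologicalSpace M] [ChartedSpace E M] [IsManifold 𝓘(ℝ, E) ∞ M]

variable (E M) in
/-- Smooth Riemannian metrics on a smooth manifold `M` modelled on `E`. -/
abbrev SmoothMetric : Type _ :=
  Bundle.ContMDiffRiemannianMetric 𝓘(ℝ, E) ∞ E (fun p : M => TangentSpace 𝓘(ℝ, E) p)

namespace SmoothMetric

variable (g : SmoothMetric E M) (p : M)

/-- The expression of the metric `g` in the preferred chart at `p`, that is, its pullback by the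
inverse of the chart. -/
def inChart (y : E) : E →L[ℝ] E →L[ℝ] ℝ :=
  let A : E →L[ℝ] E := mfderiv 𝓘(ℝ, E) 𝓘(ℝ, E) (chartAt E p).symm y
  let B : E →L[ℝ] E →L[ℝ] ℝ := g.inner ((chartAt E p).symm y)
  B.bilinearComp A A

/-- The sectional curvature at `p` of the plane spanned by two linearly independent tangent vectors,
computed in the preferred chart at `p`. -/
def secPair (u v : TangentSpace 𝓘(ℝ, E) p) : ℝ :=
  localSec (g.inChart p) (chartAt E p p)
    (mfderiv 𝓘(ℝ, E) 𝓘(ℝ, E) (chartAt E p) p u) (mfderiv 𝓘(ℝ, E) 𝓘(ℝ, E) (chartAt E p) p v)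

open Classical in
/-- The sectional curvature of a plane `σ ⊆ T_pM`, computed with a basis `u, v` of `σ` (the value
does not depend on the basis); it is set to `0` if `σ` is not a plane. -/
def sec (σ : Submodule ℝ (TangentSpace 𝓘(ℝ, E) p)) : ℝ :=
  if h : ∃ b : Fin 2 → TangentSpace 𝓘(ℝ, E) p,
      LinearIndependent ℝ b ∧ Submodule.span ℝ (Set.range b) = σ then
    g.secPair p (h.choose 0) (h.choose 1)
  else 0

/-- The `g`-orthogonal complement of a subspace `σ ⊆ T_pM`. -/
def orth (σ : Submodule ℝ (TangentSpace 𝓘(ℝ, E) p)) : Submodule ℝ (TangentSpace 𝓘(ℝ, E) p) where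
  carrier := {w | ∀ v ∈ σ, g.inner p v w = 0}
  add_mem' hw hw' v hv := by rw [map_add, hw v hv, hw' v hv, add_zero]
  zero_mem' _ _ := map_zero _
  smul_mem' c _ hw v hv := by rw [map_smul, hw v hv, smul_zero]

/-- The biorthogonal curvature `½ (sec(σ) + sec(σ^⊥))` of a plane `σ` tangent to a 4-manifold. -/
def biorthSec (σ : Submodule ℝ (TangentSpace 𝓘(ℝ, E) p)) : ℝ :=
  (g.sec p σ + g.sec p (g.orth p σ)) / 2

/-- A metric on a 4-manifold has positive biorthogonal curvature if that of every tangent plane is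
positive. -/
def PositiveBiorthogonalCurvature : Prop :=
  ∀ (p : M) (σ : Submodule ℝ (TangentSpace 𝓘(ℝ, E) p)),
    Module.finrank ℝ σ = 2 → 0 < g.biorthSec p σ

end SmoothMetric

end Curvature

end

set_option maxSynthPendingDepth 3
set_option autoImplicit false

/-! The manifold is the round 4-sphere of radius 1/2 with both poles blown up: the set of triples
(x, h, L), where L is a complex line in ℂ², x ∈ L, and |x|² + h²/4 = 1/4. It is the sphere bundle of
(tautological line) ⊕ ℝ over ℂP¹. `globalMap` realises it in ℂ² × ℝ × (2×2 matrices), a line L being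
recorded by its orthogonal projection. Each punctured ℂP² covers the part where one of the values h
= ±1 is omitted, and the inversion used for gluing becomes the identity up to the sign of h
(`ambientMap_inversion`).

The metric is the pullback of the round metric of the 4-sphere plus (1 - 9/8 |x|²) times the
Fubini–Study metric of ℂP¹ (`ambientForm`). With 1 instead of 9/8 it would be a Riemannian
submersion onto ℂP¹ with totally geodesic round fibres. Planes spanned by a vertical and a
horizontal vector would then be flat along the two sections x = 0, and their orthogonal complements
are of the same kind, so the biorthogonal curvature would vanish there. The extra 1/8 shrinks the
base slightly away from these sections and makes this curvature positive.

The group SU(2) and the reflection h ↦ -h act by isometries, and homogeneous coordinates may be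
rescaled, so every point can be moved to [r : 1 : 0] with r real. Since curvature is natural under
local isometries (`IsLocalIsometryAt.localSec_eq`), it is enough to compute at these points, in the
coordinates [z : 1 : w]. With S = 1 + r² and A = 1 - r²/(8S²) the metric is there diagonal, with
entries S⁻², S⁻², A, A, and the numerator of the sectional curvature is an explicit quadratic form
in the Plücker coordinates of the plane (`modelMetric_localRiemann`).

The Plücker coordinates of the orthogonal complement are those of the metric Hodge star
(`exists_plucker_eq`). In the sum over a plane and its complement the form splits into a binary form
in P12, P34 and a positive multiple of P13² + P14² + P23² + P24²; the binary form is positive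
definite by completing a square (`modelCurvature_add_dual_pos`). -/

noncomputable section

/-! ### Local Riemannian geometry -/

section LocalGeometry

variable {E : Type*} [NormedAddCommGroup E] [NormedSpace ℝ E]
  {E' : Type*} [NormedAddCommGroup E'] [NormedSpace ℝ E']

/-- `G` is, near `y`, a symmetric nondegenerate bilinear form of class `C²`. -/
structure IsLocalMetricAt (G : E → E →L[ℝ] E →L[ℝ] ℝ) (y : E) : Prop where
  contDiffAt : ContDiffAt ℝ 2 G y
  symm : ∀ᶠ z in 𝓝 y, ∀ a b, G z a b = G z b a
  isInvertible : (G y).IsInvertible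

lemma ContinuousLinearMap.IsInvertible.eventually [CompleteSpace E]
    {X : Type*} [TopologicalSpace X] {A : X → E →L[ℝ] E'} {x : X} (h : (A x).IsInvertible)
    (hA : ContinuousAt A x) : ∀ᶠ z in 𝓝 x, (A z).IsInvertible := by
  obtain ⟨e, he⟩ := h
  have := hA.preimage_mem_nhds (he ▸ e.nhds)
  filter_upwards [this] with z hz
  exact hz

lemma IsLocalMetricAt.eventually [CompleteSpace E] {G : E → E →L[ℝ] E →L[ℝ] ℝ} {y : E}
    (h : IsLocalMetricAt G y) : ∀ᶠ z in 𝓝 y, IsLocalMetricAt G z := by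
  filter_upwards [h.contDiffAt.eventually (by simp), h.symm.eventually_nhds,
    h.isInvertible.eventually h.contDiffAt.continuousAt] with z h1 h2 h3
  exact ⟨h1, h2, h3⟩

/-- The Koszul expression, twice the Christoffel symbol of the first kind. -/
def koszulL (D : E →L[ℝ] E →L[ℝ] E →L[ℝ] ℝ) : E →L[ℝ] E →L[ℝ] E →L[ℝ] ℝ :=
  D + D.flip - ((ContinuousLinearMap.flipₗᵢ ℝ E E ℝ).toContinuousLinearEquiv :
    (E →L[ℝ] E →L[ℝ] ℝ) →L[ℝ] (E →L[ℝ] E →L[ℝ] ℝ)).comp D.flip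

lemma koszulL_apply (D : E →L[ℝ] E →L[ℝ] E →L[ℝ] ℝ) (u v w : E) :
    koszulL D u v w = D u v w + D v u w - D w u v := rfl

lemma contDiff_koszulL {n : ℕ∞ω} :
    ContDiff ℝ n (koszulL : (E →L[ℝ] E →L[ℝ] E →L[ℝ] ℝ) → _) := by
  unfold koszulL
  have h : ContDiff ℝ n (fun D : E →L[ℝ] E →L[ℝ] E →L[ℝ] ℝ => D.flip) :=
    (ContinuousLinearMap.flipₗᵢ ℝ E E (E →L[ℝ] ℝ)).contDiff
  exact (contDiff_id.add h).sub (contDiff_const.clm_comp h)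

/-- The Christoffel symbol as a continuous bilinear map. -/
def christoffelL (G : E → E →L[ℝ] E →L[ℝ] ℝ) (y : E) : E →L[ℝ] E →L[ℝ] E :=
  (ContinuousLinearMap.compL ℝ E (E →L[ℝ] ℝ) E (G y).inverse).comp
    ((1 / 2 : ℝ) • koszulL (fderiv ℝ G y))

lemma christoffelL_apply (G : E → E →L[ℝ] E →L[ℝ] ℝ) (y v w : E) :
    christoffelL G y v w = christoffel G y v w := rfl

namespace IsLocalMetricAt

variable {G : E → E →L[ℝ] E →L[ℝ] ℝ} {y : E}

lemma apply_christoffel (h : IsLocalMetricAt G y) (v w u : E) :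
    G y (christoffel G y v w) u = 1 / 2 * koszulL (fderiv ℝ G y) v w u := by
  rw [christoffel, h.isInvertible.self_apply_inverse]
  rfl

lemma eq_of_apply_eq (h : IsLocalMetricAt G y) {a b : E} (hab : ∀ c, G y a c = G y b c) :
    a = b :=
  h.isInvertible.injective (ContinuousLinearMap.ext hab)

lemma contDiffAt_fderiv (h : IsLocalMetricAt G y) : ContDiffAt ℝ 1 (fderiv ℝ G) y :=
  h.contDiffAt.fderiv_right (by norm_num)

lemma contDiffAt_christoffelL [CompleteSpace E] (h : IsLocalMetricAt G y) :
    ContDiffAt ℝ 1 (christoffelL G) y := by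
  unfold christoffelL
  have h1 : ContDiffAt ℝ 1 (fun z => (G z).inverse) y :=
    (h.isInvertible.contDiffAt_map_inverse).comp y (h.contDiffAt.of_le (by norm_num))
  have h2 : ContDiffAt ℝ 1 (fun z => koszulL (fderiv ℝ G z)) y :=
    contDiff_koszulL.contDiffAt.comp y h.contDiffAt_fderiv
  exact ((ContinuousLinearMap.contDiff _).contDiffAt.comp y h1).clm_comp (h2.const_smul _)

lemma fderiv_symm (h : IsLocalMetricAt G y) (u a b : E) :
    fderiv ℝ G y u a b = fderiv ℝ G y u b a := by
  have h1 : DifferentiableAt ℝ G y := h.contDiffAt.differentiableAt (by norm_num)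
  have e1 : fderiv ℝ (fun z => G z a b) y u = fderiv ℝ G y u a b := by
    simpa using congrArg (fun A : E →L[ℝ] ℝ => A u)
      ((h1.hasFDerivAt.clm_apply (hasFDerivAt_const a y)).clm_apply
        (hasFDerivAt_const b y)).fderiv
  have e2 : fderiv ℝ (fun z => G z b a) y u = fderiv ℝ G y u b a := by
    simpa using congrArg (fun A : E →L[ℝ] ℝ => A u)
      ((h1.hasFDerivAt.clm_apply (hasFDerivAt_const b y)).clm_apply
        (hasFDerivAt_const a y)).fderiv
  rw [← e1, ← e2]
  congr 1
  exact Filter.EventuallyEq.fderiv_eq (h.symm.mono fun z hz => hz a b)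

/-- Compatibility of the Christoffel symbol with the metric. -/
lemma fderiv_eq (h : IsLocalMetricAt G y) (u a b : E) :
    fderiv ℝ G y u a b = G y (christoffel G y u a) b + G y (christoffel G y u b) a := by
  rw [h.apply_christoffel, h.apply_christoffel, koszulL_apply, koszulL_apply, h.fderiv_symm b u a,
    h.fderiv_symm a u b, h.fderiv_symm u b a]
  ring

lemma fderiv_christoffel [CompleteSpace E] (h : IsLocalMetricAt G y) (u v w : E) :
    fderiv ℝ (fun z => christoffel G z v w) y u = fderiv ℝ (christoffelL G) y u v w := by
  have h1 := (h.contDiffAt_christoffelL.differentiableAt (by norm_num)).hasFDerivAt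
  have h2 := congrArg (fun A : E →L[ℝ] E => A u)
    ((h1.clm_apply (hasFDerivAt_const v y)).clm_apply (hasFDerivAt_const w y)).fderiv
  simp only [christoffelL_apply] at h2
  rw [h2]
  simp

/-- The Riemann curvature in terms of the second derivatives of the metric. -/
lemma apply_localRiemann [CompleteSpace E] (h : IsLocalMetricAt G y) (u v w x : E) :
    G y (localRiemann G y u v w) x =
      1 / 2 * (koszulL (fderiv ℝ (fderiv ℝ G) y u) v w x -
        koszulL (fderiv ℝ (fderiv ℝ G) y v) u w x) -
      G y (christoffel G y v w) (christoffel G y u x) +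
      G y (christoffel G y u w) (christoffel G y v x) := by
  have hs : ∀ a b, G y a b = G y b a := h.symm.self_of_nhds
  -- The function G(Γ(v, w), x) is a combination of first derivatives of G. Differentiating it,
  -- rather than Γ, avoids the derivative of the inverse metric.
  have key : ∀ u v w x, G y (fderiv ℝ (fun z => christoffel G z v w) y u) x =
      1 / 2 * koszulL (fderiv ℝ (fderiv ℝ G) y u) v w x -
        fderiv ℝ G y u (christoffel G y v w) x := by
    intro u v w x
    have hG := (h.contDiffAt.differentiableAt (by norm_num)).hasFDerivAt
    have hC : HasFDerivAt (fun z => christoffel G z v w) _ y :=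
      (((h.contDiffAt_christoffelL.differentiableAt (by norm_num)).hasFDerivAt.clm_apply
        (hasFDerivAt_const v y)).clm_apply (hasFDerivAt_const w y)).differentiableAt.hasFDerivAt
    have h1 := ((hG.clm_apply hC).clm_apply (hasFDerivAt_const x y)).fderiv
    have hD := (h.contDiffAt_fderiv.differentiableAt (by norm_num)).hasFDerivAt
    have ha : ∀ a b c : E, HasFDerivAt (fun z => fderiv ℝ G z a b c) _ y := fun a b c =>
      (((hD.clm_apply (hasFDerivAt_const a y)).clm_apply
        (hasFDerivAt_const b y)).clm_apply (hasFDerivAt_const c y))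
    have h2 := ((((ha v w x).add (ha w v x)).sub (ha x v w)).const_mul (1 / 2 : ℝ)).fderiv
    have h3 : (fun z => G z (christoffel G z v w) x) =ᶠ[𝓝 y] fun z =>
        1 / 2 * (fderiv ℝ G z v w x + fderiv ℝ G z w v x - fderiv ℝ G z x v w) := by
      filter_upwards [h.eventually] with z hz
      rw [hz.apply_christoffel, koszulL_apply]
    have h4 := h3.fderiv_eq (𝕜 := ℝ)
    have h5 := congrArg (fun A : E →L[ℝ] ℝ => A u) (h1.symm.trans (h4.trans h2))
    simp at h5
    rw [koszulL_apply]
    have h6 : fderiv ℝ (fun z => christoffel G z v w) y u =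
        fderiv ℝ (fun z => christoffelL G z v w) y u := rfl
    rw [h6]
    linear_combination h5
  -- Applied with b a Christoffel symbol, this cancels the first-derivative terms left over in
  -- `key`.
  have hg : ∀ a b, G y (christoffel G y a b) x =
      fderiv ℝ G y a b x - G y (christoffel G y a x) b := by
    intro a b
    rw [h.fderiv_eq a b x]
    ring
  rw [localRiemann, map_sub, map_add, map_add]
  simp only [_root_.sub_apply, _root_.add_apply]
  rw [key, key, hg, hg, hs (christoffel G y u x), hs (christoffel G y v x)]
  ring

end IsLocalMetricAt

end LocalGeometry

/-! ### Naturality of the curvature under local isometries -/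

section LocalIsometry

variable {E : Type*} [NormedAddCommGroup E] [NormedSpace ℝ E]
  {E' : Type*} [NormedAddCommGroup E'] [NormedSpace ℝ E']

/-- `φ` is a local diffeomorphism of class `C³` at `x` that pulls `G'` back to `G` near `x`. -/
structure IsLocalIsometryAt (G : E → E →L[ℝ] E →L[ℝ] ℝ) (G' : E' → E' →L[ℝ] E' →L[ℝ] ℝ)
    (φ : E → E') (x : E) : Prop where
  contDiffAt : ContDiffAt ℝ 3 φ x
  isInvertible : (fderiv ℝ φ x).IsInvertible
  source : IsLocalMetricAt G x
  target : IsLocalMetricAt G' (φ x)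
  eq : ∀ᶠ z in 𝓝 x, ∀ a b, G z a b = G' (φ z) (fderiv ℝ φ z a) (fderiv ℝ φ z b)

namespace IsLocalIsometryAt

variable {G : E → E →L[ℝ] E →L[ℝ] ℝ} {G' : E' → E' →L[ℝ] E' →L[ℝ] ℝ} {φ : E → E'} {x : E}

lemma contDiffAt_fderiv (h : IsLocalIsometryAt G G' φ x) : ContDiffAt ℝ 2 (fderiv ℝ φ) x :=
  h.contDiffAt.fderiv_right (by norm_num)

/-- All conditions are open, so identities proved at x hold nearby and may be differentiated. -/
lemma eventually [CompleteSpace E] [CompleteSpace E'] (h : IsLocalIsometryAt G G' φ x) :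
    ∀ᶠ z in 𝓝 x, IsLocalIsometryAt G G' φ z := by
  filter_upwards [h.contDiffAt.eventually (by decide),
    h.isInvertible.eventually h.contDiffAt_fderiv.continuousAt, h.source.eventually,
    h.contDiffAt.continuousAt.eventually h.target.eventually, h.eq.eventually_nhds]
    with z h1 h2 h3 h4 h5
  exact ⟨h1, h2, h3, h4, h5⟩

lemma hasFDerivAt (h : IsLocalIsometryAt G G' φ x) : HasFDerivAt φ (fderiv ℝ φ x) x :=
  (h.contDiffAt.differentiableAt (by norm_num)).hasFDerivAt

lemma hasFDerivAt_fderiv (h : IsLocalIsometryAt G G' φ x) :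
    HasFDerivAt (fderiv ℝ φ) (fderiv ℝ (fderiv ℝ φ) x) x :=
  (h.contDiffAt_fderiv.differentiableAt (by norm_num)).hasFDerivAt

lemma snd_symm (h : IsLocalIsometryAt G G' φ x) (u v : E) :
    fderiv ℝ (fderiv ℝ φ) x u v = fderiv ℝ (fderiv ℝ φ) x v u :=
  (h.contDiffAt.isSymmSndFDerivAt
    (by rw [minSmoothness_of_isRCLikeNormedField]; norm_num)) u v

lemma fderiv_apply (h : IsLocalIsometryAt G G' φ x) (u a b : E) :
    fderiv ℝ G x u a b =
      fderiv ℝ G' (φ x) (fderiv ℝ φ x u) (fderiv ℝ φ x a) (fderiv ℝ φ x b) +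
      G' (φ x) (fderiv ℝ (fderiv ℝ φ) x u a) (fderiv ℝ φ x b) +
      G' (φ x) (fderiv ℝ φ x a) (fderiv ℝ (fderiv ℝ φ) x u b) := by
  have hG := (h.source.contDiffAt.differentiableAt (by norm_num)).hasFDerivAt
  have hG' := ((h.target.contDiffAt.differentiableAt (by norm_num)).hasFDerivAt).comp x
    h.hasFDerivAt
  have hL := fun a : E => h.hasFDerivAt_fderiv.clm_apply (hasFDerivAt_const a x)
  have h1 := ((hG.clm_apply (hasFDerivAt_const a x)).clm_apply (hasFDerivAt_const b x)).fderiv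
  have h2 := ((hG'.clm_apply (hL a)).clm_apply (hL b)).fderiv
  have h3 : (fun z => G z a b) =ᶠ[𝓝 x]
      fun z => (G' ∘ φ) z (fderiv ℝ φ z a) (fderiv ℝ φ z b) := by
    filter_upwards [h.eq] with z hz
    exact hz a b
  have h5 := congrArg (fun A : E →L[ℝ] ℝ => A u)
    (h1.symm.trans ((h3.fderiv_eq (𝕜 := ℝ)).trans h2))
  simp at h5
  linear_combination h5

/-- The transformation law of the Christoffel symbols. -/
lemma map_christoffel (h : IsLocalIsometryAt G G' φ x) (v w : E) :
    fderiv ℝ φ x (christoffel G x v w) =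
      christoffel G' (φ x) (fderiv ℝ φ x v) (fderiv ℝ φ x w) +
        fderiv ℝ (fderiv ℝ φ) x v w := by
  refine h.target.eq_of_apply_eq fun c => ?_
  obtain ⟨u, rfl⟩ := h.isInvertible.surjective c
  have hs : ∀ a b, G' (φ x) a b = G' (φ x) b a := h.target.symm.self_of_nhds
  rw [← h.eq.self_of_nhds, h.source.apply_christoffel, map_add, _root_.add_apply,
    h.target.apply_christoffel, koszulL_apply, koszulL_apply, h.fderiv_apply, h.fderiv_apply,
    h.fderiv_apply, h.snd_symm w v, h.snd_symm u w, h.snd_symm u v,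
    hs (fderiv ℝ φ x w), hs (fderiv ℝ (fderiv ℝ φ) x v u)]
  ring

/-- Naturality of the Riemann curvature. -/
lemma map_localRiemann [CompleteSpace E] [CompleteSpace E'] (h : IsLocalIsometryAt G G' φ x) (u v w : E) :
    fderiv ℝ φ x (localRiemann G x u v w) =
      localRiemann G' (φ x) (fderiv ℝ φ x u) (fderiv ℝ φ x v) (fderiv ℝ φ x w) := by
  have hC := (h.source.contDiffAt_christoffelL.differentiableAt (by norm_num)).hasFDerivAt
  have hC' := (h.target.contDiffAt_christoffelL.differentiableAt (by norm_num)).hasFDerivAt.comp x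
    h.hasFDerivAt
  have hD3 := ((h.contDiffAt_fderiv.fderiv_right (m := 1) (by norm_num)).differentiableAt
    (by norm_num)).hasFDerivAt
  have hL := fun a : E => h.hasFDerivAt_fderiv.clm_apply (hasFDerivAt_const a x)
  have hs3 : ∀ u v w, fderiv ℝ (fderiv ℝ (fderiv ℝ φ)) x u v w =
      fderiv ℝ (fderiv ℝ (fderiv ℝ φ)) x v u w := fun u v w => congrArg (fun A => A w)
    ((h.contDiffAt_fderiv.isSymmSndFDerivAt (by simp)) u v)
  -- This is the derivative of the transformation law of Γ. The last parenthesis is symmetric in u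
  -- and v, by the symmetry of the second and third derivatives of φ, so it disappears from R(u, v)
  -- w.
  have key : ∀ u v w : E, fderiv ℝ φ x
      (fderiv ℝ (fun z => christoffel G z v w) x u + christoffel G x u (christoffel G x v w)) =
      fderiv ℝ (fun z => christoffel G' z (fderiv ℝ φ x v) (fderiv ℝ φ x w)) (φ x)
        (fderiv ℝ φ x u) +
      christoffel G' (φ x) (fderiv ℝ φ x u)
        (christoffel G' (φ x) (fderiv ℝ φ x v) (fderiv ℝ φ x w)) +
      (christoffel G' (φ x) (fderiv ℝ (fderiv ℝ φ) x u v) (fderiv ℝ φ x w) +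
        christoffel G' (φ x) (fderiv ℝ φ x v) (fderiv ℝ (fderiv ℝ φ) x u w) +
        christoffel G' (φ x) (fderiv ℝ φ x u) (fderiv ℝ (fderiv ℝ φ) x v w) +
        fderiv ℝ (fderiv ℝ (fderiv ℝ φ)) x u v w) := by
    intro u v w
    have h1 := (h.hasFDerivAt_fderiv.clm_apply
      ((hC.clm_apply (hasFDerivAt_const v x)).clm_apply (hasFDerivAt_const w x))).fderiv
    have h2 := (((hC'.clm_apply (hL v)).clm_apply (hL w)).add
      ((hD3.clm_apply (hasFDerivAt_const v x)).clm_apply (hasFDerivAt_const w x))).fderiv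
    have h3 : (fun z => fderiv ℝ φ z (christoffelL G z v w)) =ᶠ[𝓝 x]
        (fun z => (christoffelL G' ∘ φ) z (fderiv ℝ φ z v) (fderiv ℝ φ z w)) +
          fun z => fderiv ℝ (fderiv ℝ φ) z v w := by
      filter_upwards [h.eventually] with z hz
      exact hz.map_christoffel v w
    have h5 := congrArg (fun A : E →L[ℝ] E' => A u)
      (h1.symm.trans ((h3.fderiv_eq (𝕜 := ℝ)).trans h2))
    simp at h5
    rw [map_add, h.map_christoffel u, h.map_christoffel v, h.source.fderiv_christoffel,
      h.target.fderiv_christoffel]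
    simp only [← christoffelL_apply, map_add] at h5 ⊢
    have h6 := h.map_christoffel v w
    simp only [← christoffelL_apply] at h6
    rw [← sub_eq_zero] at h5 ⊢
    rw [← h5]
    abel
  rw [localRiemann, map_sub, key, key, localRiemann, h.snd_symm u v, hs3 u v w]
  abel

lemma localSec_eq [CompleteSpace E] [CompleteSpace E'] (h : IsLocalIsometryAt G G' φ x) (u v : E) :
    localSec G x u v = localSec G' (φ x) (fderiv ℝ φ x u) (fderiv ℝ φ x v) := by
  simp only [localSec, h.eq.self_of_nhds, h.map_localRiemann]

end IsLocalIsometryAt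

end LocalIsometry

/-! ### Pullback metrics -/

section PullbackMetric
variable {E : Type*} [NormedAddCommGroup E] [NormedSpace ℝ E]
  {M : Type*} [TopologicalSpace M] [ChartedSpace E M] [IsManifold 𝓘(ℝ, E) ∞ M]
  {V : Type*} [NormedAddCommGroup V] [NormedSpace ℝ V]

lemma contDiffOn_comp_chart_symm {Φ : M → V} (hΦ : ContMDiff 𝓘(ℝ, E) 𝓘(ℝ, V) ∞ Φ) (p : M) :
    ContDiffOn ℝ ∞ (Φ ∘ (chartAt E p).symm) (chartAt E p).target := by
  rw [← contMDiffOn_iff_contDiffOn]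
  exact (hΦ.contMDiffOn (s := Set.univ)).comp
    (contMDiffOn_chart_symm (I := 𝓘(ℝ, E)) (n := ∞)) fun _ _ => Set.mem_univ _

lemma mdifferentiableAt_chartAt {p q : M} (hq : q ∈ (chartAt E p).source) :
    MDifferentiableAt 𝓘(ℝ, E) 𝓘(ℝ, E) (chartAt E p) q :=
  ((contMDiffOn_chart (I := 𝓘(ℝ, E)) (n := ∞)).contMDiffAt
    ((chartAt E p).open_source.mem_nhds hq)).mdifferentiableAt (by simp)

lemma mdifferentiableAt_chartAt_symm {p : M} {y : E} (hy : y ∈ (chartAt E p).target) :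
    MDifferentiableAt 𝓘(ℝ, E) 𝓘(ℝ, E) (chartAt E p).symm y :=
  ((contMDiffOn_chart_symm (I := 𝓘(ℝ, E)) (n := ∞)).contMDiffAt
    ((chartAt E p).open_target.mem_nhds hy)).mdifferentiableAt (by simp)

/-- The derivative of a map to a vector space, as a map on the model space. -/
def modelDeriv (Φ : M → V) (p : M) : E →L[ℝ] V := mfderiv 𝓘(ℝ, E) 𝓘(ℝ, V) Φ p

/-- The derivative of the inverse of a preferred chart, as a map on the model space. -/
def modelDerivSymm (p : M) (y : E) : E →L[ℝ] E :=
  mfderiv 𝓘(ℝ, E) 𝓘(ℝ, E) (chartAt E p).symm y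

lemma modelDeriv_modelDerivSymm {Φ : M → V} (hΦ : ContMDiff 𝓘(ℝ, E) 𝓘(ℝ, V) ∞ Φ) {p : M}
    {y : E} (hy : y ∈ (chartAt E p).target) (a : E) :
    modelDeriv Φ ((chartAt E p).symm y) (modelDerivSymm p y a) =
      fderiv ℝ (Φ ∘ (chartAt E p).symm) y a := by
  rw [← mfderiv_eq_fderiv, mfderiv_comp y (hΦ.mdifferentiable (by simp) _)
    (mdifferentiableAt_chartAt_symm hy)]
  rfl

lemma modelDeriv_apply {Φ : M → V} (hΦ : ContMDiff 𝓘(ℝ, E) 𝓘(ℝ, V) ∞ Φ) {p q : M}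
    (hq : q ∈ (chartAt E p).source) (u : E) :
    modelDeriv Φ q u =
      fderiv ℝ (Φ ∘ (chartAt E p).symm) (chartAt E p q) (modelDeriv (chartAt E p) q u) := by
  have h : Φ =ᶠ[𝓝 q] (Φ ∘ (chartAt E p).symm) ∘ chartAt E p := by
    filter_upwards [(chartAt E p).open_source.mem_nhds hq] with z hz
    simp [(chartAt E p).left_inv hz]
  have hd : MDifferentiableAt 𝓘(ℝ, E) 𝓘(ℝ, V) (Φ ∘ (chartAt E p).symm) (chartAt E p q) :=
    (hΦ.mdifferentiable (by simp) _).comp _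
      (mdifferentiableAt_chartAt_symm ((chartAt E p).map_source hq))
  unfold modelDeriv
  rw [h.mfderiv_eq, mfderiv_comp q hd (mdifferentiableAt_chartAt hq), mfderiv_eq_fderiv]
  rfl

lemma modelDeriv_chartAt_injective {p q : M} (hq : q ∈ (chartAt E p).source) :
    Function.Injective (modelDeriv (E := E) (chartAt E p) q) :=
  (mdifferentiable_chart (I := 𝓘(ℝ, E)) p).mfderiv_injective hq

/-- The field of bilinear forms `Φ^* B` on a vector space. -/
def pullbackForm (B : V → V →L[ℝ] V →L[ℝ] ℝ) (f : E → V) (y : E) : E →L[ℝ] E →L[ℝ] ℝ :=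
  (B (f y)).bilinearComp (fderiv ℝ f y) (fderiv ℝ f y)

lemma pullbackForm_apply (B : V → V →L[ℝ] V →L[ℝ] ℝ) (f : E → V) (y a b : E) :
    pullbackForm B f y a b = B (f y) (fderiv ℝ f y a) (fderiv ℝ f y b) := rfl

lemma ContDiffAt.pullbackForm {n m : ℕ∞ω} {B : V → V →L[ℝ] V →L[ℝ] ℝ} {f : E → V} {y : E}
    (hB : ContDiff ℝ n B) (hf : ContDiffAt ℝ m f y) (hn : n + 1 ≤ m) :
    ContDiffAt ℝ n (pullbackForm B f) y := by
  have h1 : ContDiffAt ℝ n (fderiv ℝ f) y := hf.fderiv_right hn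
  have h2 : ContDiffAt ℝ n (fun z => B (f z)) y :=
    hB.contDiffAt.comp y (hf.of_le (le_self_add.trans hn))
  have h3 : ContDiffAt ℝ n (fun z => (B (f z)).comp (fderiv ℝ f z)) y := h2.clm_comp h1
  have h4 : ContDiffAt ℝ n
      (fun z => ((B (f z)).comp (fderiv ℝ f z)).flip.comp (fderiv ℝ f z)) y :=
    ((ContinuousLinearMap.flipₗᵢ ℝ E V ℝ).contDiff.contDiffAt.comp y h3).clm_comp h1
  exact (ContinuousLinearMap.flipₗᵢ ℝ E E ℝ).contDiff.contDiffAt.comp y h4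

/-- The constant is the minimum of the quadratic form on the compact unit sphere. -/
lemma exists_pos_mul_norm_sq_le [FiniteDimensional ℝ E] (A : E →L[ℝ] E →L[ℝ] ℝ)
    (hA : ∀ u ≠ 0, 0 < A u u) : ∃ c > 0, ∀ u, c * ‖u‖ ^ 2 ≤ A u u := by
  obtain h | h := subsingleton_or_nontrivial E
  · exact ⟨1, one_pos, fun u => by simp [Subsingleton.elim u 0]⟩
  obtain ⟨x, hx, hmin⟩ := (isCompact_sphere (0 : E) 1).exists_isMinOn
    (NormedSpace.sphere_nonempty.2 zero_le_one)
    (f := fun u => A u u) (by fun_prop)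
  refine ⟨A x x, hA x (fun h => by simp [h] at hx), fun u => ?_⟩
  by_cases hu : u = 0
  · simp [hu]
  have hn : ‖u‖ ≠ 0 := norm_ne_zero_iff.2 hu
  have := isMinOn_iff.1 hmin (‖u‖⁻¹ • u) (by simp [norm_smul, hn])
  simp only [map_smul, _root_.smul_apply, smul_eq_mul] at this
  calc A x x * ‖u‖ ^ 2 ≤ (‖u‖⁻¹ * (‖u‖⁻¹ * A u u)) * ‖u‖ ^ 2 := by gcongr
    _ = A u u := by field_simp

lemma isVonNBounded_of_pos [FiniteDimensional ℝ E] (A : E →L[ℝ] E →L[ℝ] ℝ)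
    (hA : ∀ u ≠ 0, 0 < A u u) : Bornology.IsVonNBounded ℝ {u | A u u < 1} := by
  obtain ⟨c, hc, h⟩ := exists_pos_mul_norm_sq_le A hA
  refine NormedSpace.isVonNBounded_of_isBounded _
    ((Metric.isBounded_closedBall (x := 0) (r := √(1 / c))).subset fun u hu => ?_)
  have hu' : A u u < 1 := hu
  rw [mem_closedBall_zero_iff]
  refine Real.le_sqrt_of_sq_le ?_
  rw [le_div_iff₀ hc]
  linarith [h u]

/-- The bilinear form `Φ^* B` on a tangent space. -/
def pullbackInner (Φ : M → V) (B : V → V →L[ℝ] V →L[ℝ] ℝ) (p : M) : E →L[ℝ] E →L[ℝ] ℝ :=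
  (B (Φ p)).bilinearComp (modelDeriv Φ p) (modelDeriv Φ p)

lemma pullbackInner_eq {Φ : M → V} (hΦ : ContMDiff 𝓘(ℝ, E) 𝓘(ℝ, V) ∞ Φ)
    (B : V → V →L[ℝ] V →L[ℝ] ℝ) {p q : M} (hq : q ∈ (chartAt E p).source) (u v : E) :
    pullbackInner Φ B q u v = pullbackForm B (Φ ∘ (chartAt E p).symm) (chartAt E p q)
      (modelDeriv (chartAt E p) q u) (modelDeriv (chartAt E p) q v) := by
  rw [pullbackForm_apply, ← modelDeriv_apply hΦ hq, ← modelDeriv_apply hΦ hq,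
    Function.comp_apply, (chartAt E p).left_inv hq]
  rfl

lemma pullbackInner_pos {Φ : M → V} (hΦ : ContMDiff 𝓘(ℝ, E) 𝓘(ℝ, V) ∞ Φ)
    {B : V → V →L[ℝ] V →L[ℝ] ℝ} (hpos : ∀ (p : M) (u : E), u ≠ 0 →
      0 < pullbackForm B (Φ ∘ (chartAt E p).symm) (chartAt E p p) u u) (p : M) (u : E)
    (hu : u ≠ 0) : 0 < pullbackInner Φ B p u u := by
  rw [pullbackInner_eq hΦ B (mem_chart_source E p)]
  exact hpos p _ fun h0 => hu
    (modelDeriv_chartAt_injective (mem_chart_source E p) (h0.trans (map_zero _).symm))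

/-- The bilinear form `Φ^* B` on a tangent space, with the type of a fiber of the bundle of
bilinear forms. -/
def pullbackFiber (Φ : M → V) (B : V → V →L[ℝ] V →L[ℝ] ℝ) (p : M) :
    TangentSpace 𝓘(ℝ, E) p →L[ℝ] TangentSpace 𝓘(ℝ, E) p →L[ℝ] ℝ :=
  pullbackInner (E := E) Φ B p

lemma trivializationAt_symm_apply {p q : M} (hq : q ∈ (chartAt E p).source) (c : E) :
    (trivializationAt E (TangentSpace 𝓘(ℝ, E)) p).symm q c =
      modelDerivSymm p (chartAt E p q) c := by
  have h2 := DFunLike.congr_fun (TangentBundle.symmL_trivializationAt (I := 𝓘(ℝ, E)) hq) c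
  rw [Bundle.Trivialization.symmL_apply _ (by simpa using hq)] at h2
  rw [h2]
  simp
  rfl

/-- Smoothness is tested in the trivialization at p. There the section is the pullback of B by Φ in
the chart, an ordinary smooth function of the coordinates. -/
lemma contMDiff_pullbackInner {Φ : M → V} (hΦ : ContMDiff 𝓘(ℝ, E) 𝓘(ℝ, V) ∞ Φ)
    {B : V → V →L[ℝ] V →L[ℝ] ℝ} (hB : ContDiff ℝ ∞ B) :
    ContMDiff 𝓘(ℝ, E) (𝓘(ℝ, E).prod 𝓘(ℝ, E →L[ℝ] E →L[ℝ] ℝ)) ∞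
      (fun p : M => Bundle.TotalSpace.mk' (E →L[ℝ] E →L[ℝ] ℝ)
        (E := fun p : M => TangentSpace 𝓘(ℝ, E) p →L[ℝ] TangentSpace 𝓘(ℝ, E) p →L[ℝ] ℝ) p
        (pullbackFiber Φ B p)) := by
  intro p
  rw [contMDiffAt_hom_bundle]
  refine ⟨contMDiffAt_id, ?_⟩
  have h1 : ContMDiffAt 𝓘(ℝ, E) 𝓘(ℝ, E →L[ℝ] E →L[ℝ] ℝ) ∞
      (fun q => pullbackForm B (Φ ∘ (chartAt E p).symm) (chartAt E p q)) p := by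
    have hf := ((contDiffOn_comp_chart_symm hΦ p).contDiffAt
      ((chartAt E p).open_target.mem_nhds (mem_chart_target E p)))
    exact (hf.pullbackForm hB (by simp)).contMDiffAt.comp p
      ((contMDiffOn_chart (I := 𝓘(ℝ, E)) (n := ∞)).contMDiffAt
        ((chartAt E p).open_source.mem_nhds (mem_chart_source E p)))
  refine h1.congr_of_eventuallyEq ?_
  filter_upwards [(chartAt E p).open_source.mem_nhds (mem_chart_source E p)] with q hq
  ext a b
  refine (inCoordinates_apply_eq₂ (E₃ := fun _ : M => ℝ) (by simpa using hq) (by simpa using hq)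
    (by simp)).trans ?_
  rw [trivializationAt_symm_apply hq, trivializationAt_symm_apply hq]
  have h3 := modelDeriv_modelDerivSymm hΦ ((chartAt E p).map_source hq)
  rw [pullbackForm_apply, ← h3, ← h3]
  have h4 : (Φ ∘ (chartAt E p).symm) (chartAt E p q) = Φ q := by
    simp [(chartAt E p).left_inv hq]
  rw [h4, (chartAt E p).left_inv hq]
  have h5 : ∀ t : ℝ, (trivializationAt ℝ (fun _ : M => ℝ) p).linearMapAt ℝ q t = t :=
    fun t => by simp
  exact (h5 _).trans rfl

/-- The Riemannian metric `Φ^* B` on a manifold. -/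
def pullbackMetric [FiniteDimensional ℝ E] {Φ : M → V}
    (hΦ : ContMDiff 𝓘(ℝ, E) 𝓘(ℝ, V) ∞ Φ) {B : V → V →L[ℝ] V →L[ℝ] ℝ} (hB : ContDiff ℝ ∞ B)
    (hsymm : ∀ x a b, B x a b = B x b a)
    (hpos : ∀ (p : M) (u : E), u ≠ 0 →
      0 < pullbackForm B (Φ ∘ (chartAt E p).symm) (chartAt E p p) u u) :
    SmoothMetric E M where
  inner p := pullbackFiber Φ B p
  symm _ _ _ := hsymm _ _ _
  pos := pullbackInner_pos hΦ hpos
  isVonNBounded p := isVonNBounded_of_pos (E := E) (pullbackInner Φ B p)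
    (pullbackInner_pos hΦ hpos p)
  contMDiff := contMDiff_pullbackInner hΦ hB

/-- Passage from the manifold to local computation: on the chart target both sides are B evaluated
on the derivative of Φ ∘ chart⁻¹, by the chain rule. -/
lemma pullbackMetric_inChart [FiniteDimensional ℝ E] {Φ : M → V}
    (hΦ : ContMDiff 𝓘(ℝ, E) 𝓘(ℝ, V) ∞ Φ) {B : V → V →L[ℝ] V →L[ℝ] ℝ} (hB : ContDiff ℝ ∞ B)
    (hsymm : ∀ x a b, B x a b = B x b a)
    (hpos : ∀ (p : M) (u : E), u ≠ 0 →
      0 < pullbackForm B (Φ ∘ (chartAt E p).symm) (chartAt E p p) u u) (p : M) {y : E}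
    (hy : y ∈ (chartAt E p).target) :
    (pullbackMetric hΦ hB hsymm hpos).inChart p y = pullbackForm B (Φ ∘ (chartAt E p).symm) y := by
  ext a b
  rw [pullbackForm_apply, ← modelDeriv_modelDerivSymm hΦ hy, ← modelDeriv_modelDerivSymm hΦ hy]
  rfl

end PullbackMetric

/-! ### Positive biorthogonal curvature in charts -/

section Biorthogonal

variable {E : Type*} [NormedAddCommGroup E] [NormedSpace ℝ E]

/-- The metric `G` has positive biorthogonal curvature at `y`. -/
def PosBiorthAt (G : E → E →L[ℝ] E →L[ℝ] ℝ) (y : E) : Prop :=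
  ∀ b c : Fin 2 → E, LinearIndependent ℝ b → LinearIndependent ℝ c →
    (∀ i j, G y (b i) (c j) = 0) → 0 < localSec G y (b 0) (b 1) + localSec G y (c 0) (c 1)

lemma PosBiorthAt.map {E' : Type*} [NormedAddCommGroup E'] [NormedSpace ℝ E'] [CompleteSpace E]
    [CompleteSpace E'] {G : E → E →L[ℝ] E →L[ℝ] ℝ} {G' : E' → E' →L[ℝ] E' →L[ℝ] ℝ} {φ : E → E'}
    {x : E} (hG : PosBiorthAt G x) (h : IsLocalIsometryAt G G' φ x) : PosBiorthAt G' (φ x) := by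
  intro b c hb hc hbc
  obtain ⟨e, he⟩ := h.isInvertible
  have key : ∀ a : E', fderiv ℝ φ x (e.symm a) = a := fun a => by
    rw [← he]
    exact e.apply_symm_apply a
  have := hG (e.symm ∘ b) (e.symm ∘ c) (hb.map' (e.symm : E' →ₗ[ℝ] E) (by simp))
    (hc.map' (e.symm : E' →ₗ[ℝ] E) (by simp)) fun i j => by
      rw [h.eq.self_of_nhds]
      simp only [Function.comp_apply, key]
      exact hbc i j
  simpa only [h.localSec_eq, Function.comp_apply, key] using this

variable {M : Type*} [TopologicalSpace M] [ChartedSpace E M] [IsManifold 𝓘(ℝ, E) ∞ M]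

namespace SmoothMetric

variable (g : SmoothMetric E M) (p : M)

/-- The metric at a point as a bilinear form on the model space. -/
def modelInner (q : M) : E →L[ℝ] E →L[ℝ] ℝ := g.inner q

lemma inChart_apply (u v : E) :
    g.inChart p (chartAt E p p) (modelDeriv (E := E) (chartAt E p) p u)
      (modelDeriv (E := E) (chartAt E p) p v) = g.modelInner p u v := by
  have h : ∀ u : E, modelDerivSymm p (chartAt E p p) (modelDeriv (E := E) (chartAt E p) p u) = u :=
    fun u => DFunLike.congr_fun
      ((mdifferentiable_chart (I := 𝓘(ℝ, E)) p).symm_comp_deriv (mem_chart_source E p)) u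
  have h1 : g.inChart p (chartAt E p p) (modelDeriv (E := E) (chartAt E p) p u)
      (modelDeriv (E := E) (chartAt E p) p v) =
    g.modelInner ((chartAt E p).symm (chartAt E p p))
      (modelDerivSymm p (chartAt E p p) (modelDeriv (E := E) (chartAt E p) p u))
      (modelDerivSymm p (chartAt E p p) (modelDeriv (E := E) (chartAt E p) p v)) := rfl
  rw [h1, h, h, (chartAt E p).left_inv (mem_chart_source E p)]

lemma exists_basis_of_finrank {F : Type*} [AddCommGroup F] [Module ℝ F] (σ : Submodule ℝ F)
    (h : Module.finrank ℝ σ = 2) :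
    ∃ b : Fin 2 → F, LinearIndependent ℝ b ∧ Submodule.span ℝ (Set.range b) = σ := by
  have : Module.Finite ℝ σ := Module.finite_of_finrank_pos (by omega)
  let b := Module.finBasisOfFinrankEq ℝ σ h
  refine ⟨Subtype.val ∘ b, b.linearIndependent.map' σ.subtype (by simp), ?_⟩
  have h2 := congrArg (Submodule.map σ.subtype) b.span_eq
  rw [Submodule.map_span, ← Set.range_comp] at h2
  simpa using h2

lemma finrank_orth [FiniteDimensional ℝ E] (hE : Module.finrank ℝ E = 4)
    (σ : Submodule ℝ (TangentSpace 𝓘(ℝ, E) p)) (hσ : Module.finrank ℝ σ = 2) :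
    Module.finrank ℝ (g.orth p σ) = 2 := by
  let B : LinearMap.BilinForm ℝ (TangentSpace 𝓘(ℝ, E) p) :=
    LinearMap.mk₂ ℝ (fun u v => g.inner p u v) (by simp) (by simp) (by simp) (by simp)
  have hB : B.Nondegenerate := by
    have h : ∀ u, B u u = 0 → u = 0 := fun u hu => by
      by_contra h0
      exact (g.pos p u h0).ne' hu
    exact ⟨fun u hu => h u (hu u), fun u hu => h u (hu u)⟩
  have : FiniteDimensional ℝ (TangentSpace 𝓘(ℝ, E) p) := ‹FiniteDimensional ℝ E›
  -- The dimension formula for a nondegenerate form gives 4 - 2 = 2.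
  have h1 := LinearMap.BilinForm.finrank_orthogonal hB σ
  have h2 : B.orthogonal σ = g.orth p σ := by
    ext w
    rfl
  have h3 : Module.finrank ℝ (TangentSpace 𝓘(ℝ, E) p) = 4 := hE
  rw [h2, hσ, h3] at h1
  exact h1

/-- The basis is the one picked by choice in the definition of `sec`. As `PosBiorthAt` quantifies
over all bases, independence of the basis is never needed. -/
lemma sec_eq (σ : Submodule ℝ (TangentSpace 𝓘(ℝ, E) p)) (hσ : Module.finrank ℝ σ = 2) :
    ∃ b : Fin 2 → TangentSpace 𝓘(ℝ, E) p, LinearIndependent ℝ b ∧ (∀ i, b i ∈ σ) ∧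
      g.sec p σ = localSec (g.inChart p) (chartAt E p p)
        (modelDeriv (E := E) (chartAt E p) p (b 0)) (modelDeriv (E := E) (chartAt E p) p (b 1)) := by
  have h := exists_basis_of_finrank σ hσ
  refine ⟨h.choose, h.choose_spec.1, fun i => ?_, ?_⟩
  · have := h.choose_spec.2.le (Submodule.subset_span (Set.mem_range_self i))
    exact this
  · rw [sec, dif_pos h]
    rfl

theorem positiveBiorthogonalCurvature_of_chart [FiniteDimensional ℝ E]
    (hE : Module.finrank ℝ E = 4)
    (h : ∀ p : M, PosBiorthAt (g.inChart p) (chartAt E p p)) :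
    g.PositiveBiorthogonalCurvature := by
  intro p σ hσ
  obtain ⟨b, hb, hbσ, hbs⟩ := g.sec_eq p σ hσ
  obtain ⟨c, hc, hcσ, hcs⟩ := g.sec_eq p (g.orth p σ) (g.finrank_orth p hE σ hσ)
  have hT : LinearMap.ker (modelDeriv (E := E) (chartAt E p) p : E →ₗ[ℝ] E) = ⊥ :=
    LinearMap.ker_eq_bot.2 (modelDeriv_chartAt_injective (mem_chart_source E p))
  have := h p _ _ (hb.map' _ hT) (hc.map' _ hT) fun i j => by
    have h1 := g.inChart_apply p (b i) (c j)
    have h2 : g.modelInner p (b i) (c j) = 0 := hcσ j (b i) (hbσ i)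
    exact h1.trans h2
  rw [biorthSec, hbs, hcs]
  exact half_pos this

end SmoothMetric

end Biorthogonal

/-! ### The ambient space -/

section Ambient

open ComplexConjugate RealInnerProductSpace

/-- The vector space to which `ℂP² # -ℂP²` is mapped. -/
abbrev Ambient : Type := EuclideanSpace ℂ (Fin 2) × ℝ × EuclideanSpace ℂ (Fin 2 × Fin 2)

/-- The field of bilinear forms on the ambient space whose pullback is the metric. -/
def ambientForm (x : Ambient) : Ambient →L[ℝ] Ambient →L[ℝ] ℝ :=
  (innerSL ℝ).bilinearComp (.fst ℝ _ _) (.fst ℝ _ _) +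
  -- The height runs over [-1, 1]; the factor 1/4 makes the first two components a round sphere of
  -- radius 1/2.
  (1 / 4 : ℝ) • (innerSL ℝ).bilinearComp (.fst ℝ _ _ ∘L .snd ℝ _ _) (.fst ℝ _ _ ∘L .snd ℝ _ _) +
  -- Half the squared Frobenius norm of the derivative of the projection is the Fubini–Study metric.
  -- The coefficient is negative for large ‖x.1‖, but ‖x.1‖ ≤ 1/2 on the image of the manifold.
  (1 / 2 * (1 - 9 / 8 * ‖x.1‖ ^ 2)) •
    (innerSL ℝ).bilinearComp (.snd ℝ _ _ ∘L .snd ℝ _ _) (.snd ℝ _ _ ∘L .snd ℝ _ _)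

lemma ambientForm_apply (x a b : Ambient) :
    ambientForm x a b = ⟪a.1, b.1⟫ + 1 / 4 * (a.2.1 * b.2.1) +
      1 / 2 * (1 - 9 / 8 * ‖x.1‖ ^ 2) * ⟪a.2.2, b.2.2⟫ := by
  simp [ambientForm, mul_comm]

lemma ambientForm_symm (x a b : Ambient) : ambientForm x a b = ambientForm x b a := by
  rw [ambientForm_apply, ambientForm_apply, real_inner_comm, real_inner_comm a.2.2,
    mul_comm a.2.1]

lemma contDiff_ambientForm : ContDiff ℝ ∞ ambientForm := by
  unfold ambientForm
  have h : ContDiff ℝ ∞ fun x : Ambient => ‖x.1‖ ^ 2 := (contDiff_norm_sq ℝ).comp contDiff_fst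
  fun_prop

/-- The sum `|u₁|² + |u₂|²`. -/
def normSqTail (u : Fin 3 → ℂ) : ℝ := Complex.normSq (u 1) + Complex.normSq (u 2)

/-- The map to the ambient space in homogeneous coordinates; the sign `s` distinguishes the two
summands of the connected sum. -/
def ambientMap (s : ℝ) (u : Fin 3 → ℂ) : Ambient :=
  (WithLp.toLp 2 fun j => (Complex.normSq (u 0) + normSqTail u)⁻¹ • (conj (u 0) * u j.succ),
    s * ((Complex.normSq (u 0) + normSqTail u)⁻¹ * (Complex.normSq (u 0) - normSqTail u)),
    WithLp.toLp 2 fun k => (normSqTail u)⁻¹ • (u k.1.succ * conj (u k.2.succ)))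

lemma normSqTail_nonneg (u : Fin 3 → ℂ) : 0 ≤ normSqTail u :=
  add_nonneg (Complex.normSq_nonneg _) (Complex.normSq_nonneg _)

/-- Every component is a quotient of expressions scaling by |c|², so the map descends to ℂP² minus
[1 : 0 : 0]. -/
lemma ambientMap_smul (s : ℝ) {c : ℂ} (hc : c ≠ 0) (u : Fin 3 → ℂ) :
    ambientMap s (fun k => c * u k) = ambientMap s u := by
  have hc' : Complex.normSq c ≠ 0 := by simpa using hc
  have h1 : ∀ x y : ℂ, c * x * conj (c * y) = Complex.normSq c • (x * conj y) := by
    intro x y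
    rw [map_mul, Complex.real_smul, ← Complex.mul_conj]
    ring
  have h2 : ∀ x y : ℂ, conj (c * x) * (c * y) = Complex.normSq c • (conj x * y) := by
    intro x y
    rw [map_mul, Complex.real_smul, ← Complex.mul_conj]
    ring
  have h3 : normSqTail (fun k => c * u k) = Complex.normSq c * normSqTail u := by
    simp only [normSqTail, Complex.normSq_mul]
    ring
  simp only [ambientMap, h1, h2, h3, Complex.normSq_mul, ← mul_add, ← mul_sub, smul_smul, mul_inv]
  field_simp

/-- The action of `SU(2)` on the last two homogeneous coordinates. -/
def rotTail (α β : ℂ) (u : Fin 3 → ℂ) : Fin 3 → ℂ :=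
  ![u 0, α * u 1 - conj β * u 2, β * u 1 + conj α * u 2]

lemma normSqTail_rotTail {α β : ℂ} (h : Complex.normSq α + Complex.normSq β = 1)
    (u : Fin 3 → ℂ) : normSqTail (rotTail α β u) = normSqTail u := by
  have : normSqTail (rotTail α β u) =
      (Complex.normSq α + Complex.normSq β) * normSqTail u := by
    simp [normSqTail, rotTail, Complex.normSq_apply]
    ring
  rw [this, h, one_mul]

/-- The matrix of `rotTail`. -/
def rotMatrix (α β : ℂ) : Matrix (Fin 2) (Fin 2) ℂ := !![α, -conj β; β, conj α]

/-- The action of `SU(2)` (and of the sign `s`) on the ambient space. -/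
def ambientRot (s : ℝ) (α β : ℂ) : Ambient →L[ℝ] Ambient :=
  LinearMap.toContinuousLinearMap
    { toFun := fun x =>
        (WithLp.toLp 2 fun i => ∑ k, rotMatrix α β i k * x.1 k, s * x.2.1,
          WithLp.toLp 2 fun i => ∑ k, ∑ l, rotMatrix α β i.1 k * x.2.2 (k, l) *
            conj (rotMatrix α β i.2 l))
      map_add' := fun x y => by
        refine Prod.ext ?_ (Prod.ext ?_ ?_)
        · ext i
          simp [mul_add, Finset.sum_add_distrib]
        · simp [mul_add]
        · ext i
          simp only [Prod.snd_add, PiLp.add_apply, mul_add, add_mul, Finset.sum_add_distrib]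
      map_smul' := fun c x => by
        refine Prod.ext ?_ (Prod.ext ?_ ?_)
        · ext i
          simp [mul_left_comm]
        · simp [mul_left_comm]
        · ext i
          simp
          ring }

lemma ambientRot_apply (s : ℝ) (α β : ℂ) (x : Ambient) : ambientRot s α β x =
    (WithLp.toLp 2 fun i => ∑ k, rotMatrix α β i k * x.1 k, s * x.2.1,
          WithLp.toLp 2 fun i => ∑ k, ∑ l, rotMatrix α β i.1 k * x.2.2 (k, l) *
            conj (rotMatrix α β i.2 l)) := rfl

/-- Equivariance: a unitary matrix acts on the vector x in the line, and by conjugation on the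
projection to the line. -/
lemma ambientRot_ambientMap (s : ℝ) {α β : ℂ} (h : Complex.normSq α + Complex.normSq β = 1)
    (u : Fin 3 → ℂ) : ambientRot s α β (ambientMap 1 u) = ambientMap s (rotTail α β u) := by
  rw [ambientRot_apply, ambientMap, ambientMap, normSqTail_rotTail h]
  have h0 : rotTail α β u 0 = u 0 := rfl
  have h1 : ∀ i : Fin 2, rotTail α β u i.succ = ∑ k, rotMatrix α β i k * u k.succ := by
    intro i
    fin_cases i <;> simp [rotTail, rotMatrix, sub_eq_add_neg]
  refine Prod.ext ?_ (Prod.ext ?_ ?_)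
  · ext i
    simp only [h0, h1, Finset.mul_sum, Finset.smul_sum, Complex.real_smul]
    exact Finset.sum_congr rfl fun k _ => by ring
  · simp [h0]
  · ext i
    simp only [h1, Finset.mul_sum, Finset.sum_mul, Finset.smul_sum, Complex.real_smul, map_sum,
      map_mul]
    rw [Finset.sum_comm]
    exact Finset.sum_congr rfl fun k _ => Finset.sum_congr rfl fun l _ => by ring

lemma inner_rot_fst {α β : ℂ} (h : Complex.normSq α + Complex.normSq β = 1)
    (s : ℝ) (a b : Ambient) :
    ⟪(ambientRot s α β a).1, (ambientRot s α β b).1⟫ = ⟪a.1, b.1⟫ := by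
  have : ⟪(ambientRot s α β a).1, (ambientRot s α β b).1⟫ =
      (Complex.normSq α + Complex.normSq β) * ⟪a.1, b.1⟫ := by
    simp [ambientRot_apply, PiLp.inner_apply, rotMatrix, Complex.inner, Complex.normSq_apply]
    ring
  rw [this, h, one_mul]

lemma inner_rot_snd {α β : ℂ} (h : Complex.normSq α + Complex.normSq β = 1)
    (s : ℝ) (a b : Ambient) :
    ⟪(ambientRot s α β a).2.2, (ambientRot s α β b).2.2⟫ = ⟪a.2.2, b.2.2⟫ := by
  have : ⟪(ambientRot s α β a).2.2, (ambientRot s α β b).2.2⟫ =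
      (Complex.normSq α + Complex.normSq β) ^ 2 * ⟪a.2.2, b.2.2⟫ := by
    simp [ambientRot_apply, PiLp.inner_apply, rotMatrix, Complex.inner, Complex.normSq_apply,
      Fintype.sum_prod_type]
    ring
  rw [this, h, one_pow, one_mul]

lemma ambientForm_rot {α β : ℂ} (h : Complex.normSq α + Complex.normSq β = 1)
    {s : ℝ} (hs : s ^ 2 = 1) (x a b : Ambient) :
    ambientForm (ambientRot s α β x) (ambientRot s α β a) (ambientRot s α β b) =
      ambientForm x a b := by
  rw [ambientForm_apply, ambientForm_apply, inner_rot_fst h, inner_rot_snd h,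
    ← real_inner_self_eq_norm_sq, ← real_inner_self_eq_norm_sq, inner_rot_fst h]
  simp only [ambientRot_apply]
  linear_combination (1 / 4 * (a.2.1 * b.2.1)) * hs

end Ambient

/-! ### The embedding in the coordinates [z : 1 : w] and its derivative -/

section ModelMap

open ComplexConjugate RealInnerProductSpace

lemma contDiff_normSq {n : ℕ∞ω} : ContDiff ℝ n Complex.normSq := by
  have : (Complex.normSq : ℂ → ℝ) = fun z => ‖z‖ ^ 2 := funext Complex.normSq_eq_norm_sq
  rw [this]
  exact contDiff_norm_sq ℝ

lemma ContDiffAt.ambientMap {E : Type*} [NormedAddCommGroup E] [NormedSpace ℝ E] {n : ℕ∞ω}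
    {u : E → Fin 3 → ℂ} {x : E} (hu : ContDiffAt ℝ n u x) (h : normSqTail (u x) ≠ 0) (s : ℝ) :
    ContDiffAt ℝ n (fun y => ambientMap s (u y)) x := by
  have hk : ∀ k, ContDiffAt ℝ n (fun y => u y k) x := contDiffAt_pi.1 hu
  have hn : ∀ k, ContDiffAt ℝ n (fun y => Complex.normSq (u y k)) x := fun k =>
    contDiff_normSq.contDiffAt.comp x (hk k)
  have hc : ∀ k, ContDiffAt ℝ n (fun y => conj (u y k)) x := fun k =>
    Complex.conjCLE.contDiff.contDiffAt.comp x (hk k)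
  have ht : ContDiffAt ℝ n (fun y => normSqTail (u y)) x := (hn 1).add (hn 2)
  have hS : Complex.normSq (u x 0) + normSqTail (u x) ≠ 0 :=
    (add_pos_of_nonneg_of_pos (Complex.normSq_nonneg _)
      ((normSqTail_nonneg _).lt_of_ne' h)).ne'
  unfold _root_.ambientMap
  refine ContDiffAt.prodMk ?_ (ContDiffAt.prodMk ?_ ?_)
  · exact contDiffAt_piLp _ |>.2 fun j => (((hn 0).add ht).inv hS).smul ((hc 0).mul (hk _))
  · exact contDiffAt_const.mul ((((hn 0).add ht).inv hS).mul ((hn 0).sub ht))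
  · exact contDiffAt_piLp _ |>.2 fun j => (ht.inv h).smul ((hk _).mul (hc _))

/-- The map to the ambient space in the coordinates `[z : 1 : w]`. -/
def modelMap (y : ℂ × ℂ) : Ambient := ambientMap 1 ![y.1, 1, y.2]

lemma normSqTail_model (z w : ℂ) : normSqTail ![z, 1, w] = 1 + Complex.normSq w := by
  simp [normSqTail]

lemma one_add_normSq_pos (w : ℂ) : 0 < 1 + Complex.normSq w :=
  add_pos_of_pos_of_nonneg one_pos (Complex.normSq_nonneg _)

lemma contDiff_modelMap : ContDiff ℝ ∞ modelMap := by
  rw [contDiff_iff_contDiffAt]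
  intro y
  refine ContDiffAt.ambientMap (u := fun y : ℂ × ℂ => ![y.1, 1, y.2]) ?_ ?_ 1
  · refine contDiffAt_pi.2 fun k => ?_
    fin_cases k
    · exact contDiffAt_fst
    · exact contDiffAt_const
    · exact contDiffAt_snd
  · rw [normSqTail_model]
    exact (one_add_normSq_pos _).ne'

lemma hasDerivAt_line (z a : ℂ) : HasDerivAt (fun t : ℝ => z + (t : ℂ) * a) a 0 := by
  simpa using ((Complex.ofRealCLM.hasDerivAt (x := 0)).mul_const a).const_add z

lemma hasDerivAt_conj_line (z a : ℂ) :
    HasDerivAt (fun t : ℝ => conj (z + (t : ℂ) * a)) (conj a) 0 :=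
  Complex.conjCLE.hasFDerivAt.comp_hasDerivAt (0 : ℝ) (hasDerivAt_line z a)

lemma hasDerivAt_normSq_line (z a : ℂ) :
    HasDerivAt (fun t : ℝ => Complex.normSq (z + (t : ℂ) * a))
      (2 * (z.re * a.re + z.im * a.im)) 0 := by
  have h := (((hasDerivAt_id (0 : ℝ)).mul_const a.re).const_add z.re).pow 2 |>.add
    ((((hasDerivAt_id (0 : ℝ)).mul_const a.im).const_add z.im).pow 2)
  refine (h.congr_deriv ?_).congr_of_eventuallyEq (.of_forall fun t => ?_)
  · simp
    ring
  · simp [Complex.normSq_apply]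
    ring

/-- `⟨z, a⟩` for complex numbers as real vectors. -/
def reDot (z a : ℂ) : ℝ := z.re * a.re + z.im * a.im

lemma hasDerivAt_comp_line {F : Type*} [NormedAddCommGroup F] [NormedSpace ℝ F]
    (L : Ambient →L[ℝ] F) (y a : ℂ × ℂ) :
    HasDerivAt (fun t : ℝ => L (modelMap (y.1 + (t : ℂ) * a.1, y.2 + (t : ℂ) * a.2)))
      (L (fderiv ℝ modelMap y a)) 0 := by
  have h1 : HasDerivAt (fun t : ℝ => (y.1 + (t : ℂ) * a.1, y.2 + (t : ℂ) * a.2)) a 0 :=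
    (hasDerivAt_line y.1 a.1).prodMk (hasDerivAt_line y.2 a.2)
  have h2 : HasFDerivAt modelMap (fderiv ℝ modelMap y)
      ((fun t : ℝ => (y.1 + (t : ℂ) * a.1, y.2 + (t : ℂ) * a.2)) 0) := by
    simpa using (contDiff_modelMap.differentiable (by simp) y).hasFDerivAt
  have h3 := L.hasFDerivAt.comp_hasDerivAt (0 : ℝ) (h2.comp_hasDerivAt (0 : ℝ) h1)
  exact h3

/-- Each component is differentiated along the real line y + t a and compared with the chain rule.
Here D = 1 + |w|², S = |z|² + D, and D', S' are their derivatives in the direction a. -/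
lemma fderiv_modelMap (y a : ℂ × ℂ) {D S D' S' : ℝ} (eD : D = 1 + Complex.normSq y.2)
    (eS : S = Complex.normSq y.1 + D) (eD' : D' = 2 * reDot y.2 a.2)
    (eS' : S' = 2 * reDot y.1 a.1 + D') :
    fderiv ℝ modelMap y a =
      (!₂[S⁻¹ • conj a.1 + (-S' / S ^ 2) • conj y.1,
          S⁻¹ • (conj a.1 * y.2 + conj y.1 * a.2) + (-S' / S ^ 2) • (conj y.1 * y.2)],
        S⁻¹ * (2 * reDot y.1 a.1 - D') + (-S' / S ^ 2) * (Complex.normSq y.1 - D),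
        WithLp.toLp 2 fun k =>
          ![![((-D' / D ^ 2 : ℝ) : ℂ), D⁻¹ • conj a.2 + (-D' / D ^ 2) • conj y.2],
            ![D⁻¹ • a.2 + (-D' / D ^ 2) • y.2,
            D⁻¹ • (a.2 * conj y.2 + y.2 * conj a.2) + (-D' / D ^ 2) • (y.2 * conj y.2)]]
            k.1 k.2) := by
  have hD : 0 < D := eD ▸ one_add_normSq_pos _
  have hS : 0 < S := eS ▸ add_pos_of_nonneg_of_pos (Complex.normSq_nonneg _) hD
  have dD : HasDerivAt (fun t : ℝ => 1 + Complex.normSq (y.2 + (t : ℂ) * a.2)) D' 0 :=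
    eD' ▸ (hasDerivAt_normSq_line y.2 a.2).const_add 1
  have dP := hasDerivAt_normSq_line y.1 a.1
  have dS := dP.add dD
  have dDi := dD.inv (by simpa [← eD] using hD.ne')
  have dSi := dS.inv (by simpa [← eD, ← eS] using hS.ne')
  have dz := hasDerivAt_conj_line y.1 a.1
  have dw := hasDerivAt_line y.2 a.2
  have dw' := hasDerivAt_conj_line y.2 a.2
  refine Prod.ext ?_ (Prod.ext ?_ ?_)
  · ext j
    have h := hasDerivAt_comp_line ((PiLp.proj 2 (fun _ : Fin 2 => ℂ) j : _ →L[ℝ] ℂ) ∘L .fst ℝ _ _) y a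
    fin_cases j
    · refine h.unique ((dSi.smul dz).congr_deriv ?_ |>.congr_of_eventuallyEq
        (.of_forall fun t => ?_))
      · simp [← eD, ← eS, eS', reDot]
      · simp [modelMap, ambientMap, normSqTail_model]
        ring
    · refine h.unique ((dSi.smul (dz.mul dw)).congr_deriv ?_ |>.congr_of_eventuallyEq
        (.of_forall fun t => ?_))
      · simp [← eD, ← eS, eS', reDot]
      · simp [modelMap, ambientMap, normSqTail_model]
  · have h := hasDerivAt_comp_line ((ContinuousLinearMap.fst ℝ _ _) ∘L .snd ℝ _ _) y a
    refine h.unique ((dSi.mul (dP.sub dD)).congr_deriv ?_ |>.congr_of_eventuallyEq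
        (.of_forall fun t => ?_))
    · simp [← eD, ← eS, eS', reDot]
      ring
    · simp [modelMap, ambientMap, normSqTail_model]
  · ext ⟨i, j⟩
    have h := hasDerivAt_comp_line ((PiLp.proj 2 (fun _ : Fin 2 × Fin 2 => ℂ) (i, j) : _ →L[ℝ] ℂ) ∘L
      .snd ℝ _ _ ∘L .snd ℝ _ _) y a
    fin_cases i <;> fin_cases j
    · refine h.unique ((dDi.smul_const (1 : ℂ)).congr_deriv ?_ |>.congr_of_eventuallyEq
        (.of_forall fun t => ?_))
      · simp [← eD]
      · simp [modelMap, ambientMap, normSqTail_model]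
    · refine h.unique ((dDi.smul dw').congr_deriv ?_ |>.congr_of_eventuallyEq
        (.of_forall fun t => ?_))
      · simp [← eD]
      · simp [modelMap, ambientMap, normSqTail_model]
        ring
    · refine h.unique ((dDi.smul dw).congr_deriv ?_ |>.congr_of_eventuallyEq
        (.of_forall fun t => ?_))
      · simp [← eD]
      · simp [modelMap, ambientMap, normSqTail_model]
        ring
    · refine h.unique ((dDi.smul (dw.mul dw')).congr_deriv ?_ |>.congr_of_eventuallyEq
        (.of_forall fun t => ?_))
      · simp [← eD]
      · simp [modelMap, ambientMap, normSqTail_model]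

/-- The numerator of the vertical part of a tangent vector. -/
def vertical (y a : ℂ × ℂ) : ℂ :=
  (1 + Complex.normSq y.2 : ℝ) * a.1 - y.1 * conj y.2 * a.2

/-- The projection matrix depends on w only; this is the Fubini–Study metric of ℂP¹ in the
coordinate w. -/
lemma inner_fderiv_snd (y a b : ℂ × ℂ) :
    1 / 2 * ⟪(fderiv ℝ modelMap y a).2.2, (fderiv ℝ modelMap y b).2.2⟫ =
      reDot a.2 b.2 / (1 + Complex.normSq y.2) ^ 2 := by
  obtain ⟨D, hD⟩ : ∃ D, D = 1 + Complex.normSq y.2 := ⟨_, rfl⟩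
  have hD0 : D ≠ 0 := (hD ▸ one_add_normSq_pos y.2).ne'
  rw [fderiv_modelMap y a hD rfl rfl rfl, fderiv_modelMap y b hD rfl rfl rfl, ← hD]
  have hD' : D = 1 + (y.2.re ^ 2 + y.2.im ^ 2) := by rw [hD, Complex.normSq_apply]; ring
  obtain ⟨s, hs⟩ : ∃ s, s = D⁻¹ := ⟨_, rfl⟩
  obtain ⟨p, hp⟩ : ∃ p, p = -(2 * reDot y.2 a.2) / D ^ 2 := ⟨_, rfl⟩
  obtain ⟨q, hq⟩ : ∃ q, q = -(2 * reDot y.2 b.2) / D ^ 2 := ⟨_, rfl⟩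
  have hp' : p = -2 * reDot y.2 a.2 * s ^ 2 := by rw [hp, hs]; ring
  have hq' : q = -2 * reDot y.2 b.2 * s ^ 2 := by rw [hq, hs]; ring
  rw [← hp, ← hq, ← hs, div_eq_mul_inv (reDot _ _), ← inv_pow, ← hs]
  simp only [PiLp.inner_apply, Complex.inner, Fintype.sum_prod_type, Fin.sum_univ_two]
  simp [-Complex.real_smul, Complex.smul_re, Complex.smul_im]
  rw [hp', hq']
  have hsD : s * (1 + (y.2.re ^ 2 + y.2.im ^ 2)) = 1 := by rw [← hD', hs, inv_mul_cancel₀ hD0]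
  simp only [reDot]
  linear_combination 2 * (y.2.re * a.2.re + y.2.im * a.2.im) *
    (y.2.re * b.2.re + y.2.im * b.2.im) * s ^ 2 *
    (s * (1 + (y.2.re ^ 2 + y.2.im ^ 2)) - 1) * hsD

/-- The rational identity behind the pullback of the round metric. With N = z̄ (1, w), so that x =
N/S, P = |z|² and |N|² = P D, the quantities pa, da, pb, db are the derivatives of P and D in two
directions, and nn is the inner product of the two derivatives of N. -/
lemma inner_fderiv_fst_aux {s S P D pa da pb db nn n t : ℝ} (hsS : s * S = 1) (hS : S = P + D)
    (htD : t * D = 1) (h : D * (nn - (pa * db + da * pb) / 2) = n) :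
    s ^ 2 * nn - s ^ 3 / 2 * ((pb + db) * (pa * D + P * da) + (pa + da) * (pb * D + P * db)) +
      s ^ 4 * ((pa + da) * (pb + db)) * (P * D) +
      4⁻¹ * ((s * (pa - da) - s ^ 2 * (pa + da) * (P - D)) *
        (s * (pb - db) - s ^ 2 * (pb + db) * (P - D))) = n * (t * s ^ 2) := by
  have hD : D ≠ 0 := right_ne_zero_of_mul_eq_one htD
  have hS0 : S ≠ 0 := right_ne_zero_of_mul_eq_one hsS
  rw [← h, eq_inv_of_mul_eq_one_left hsS, eq_inv_of_mul_eq_one_left htD]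
  field_simp
  rw [hS]
  ring

/-- The pulled-back round metric. `vertical` vanishes on the vectors orthogonal to the fibres w =
const, and such vectors contribute only through |z|², because moving the line L moves x at speed
proportional to |x|. -/
lemma inner_fderiv_fst (y a b : ℂ × ℂ) :
    ⟪(fderiv ℝ modelMap y a).1, (fderiv ℝ modelMap y b).1⟫ +
      1 / 4 * ((fderiv ℝ modelMap y a).2.1 * (fderiv ℝ modelMap y b).2.1) =
      (reDot (vertical y a) (vertical y b) + Complex.normSq y.1 * reDot a.2 b.2) /
        ((1 + Complex.normSq y.2) *
          (Complex.normSq y.1 + (1 + Complex.normSq y.2)) ^ 2) := by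
  obtain ⟨D, hD⟩ : ∃ D, D = 1 + Complex.normSq y.2 := ⟨_, rfl⟩
  obtain ⟨S, hS⟩ : ∃ S, S = Complex.normSq y.1 + D := ⟨_, rfl⟩
  have hD0 : 0 < D := (hD ▸ one_add_normSq_pos y.2)
  have hS0 : S ≠ 0 := (hS ▸ add_pos_of_nonneg_of_pos (Complex.normSq_nonneg _) hD0).ne'
  rw [fderiv_modelMap y a hD hS rfl rfl, fderiv_modelMap y b hD hS rfl rfl, vertical, vertical,
    ← hD, ← hS]
  have hD' : D = 1 + (y.2.re ^ 2 + y.2.im ^ 2) := by rw [hD, Complex.normSq_apply]; ring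
  obtain ⟨P, hP⟩ : ∃ P, P = Complex.normSq y.1 := ⟨_, rfl⟩
  have hP' : P = y.1.re ^ 2 + y.1.im ^ 2 := by rw [hP, Complex.normSq_apply]; ring
  have hSP : S = P + D := hP ▸ hS
  obtain ⟨s, hs⟩ : ∃ s, s = S⁻¹ := ⟨_, rfl⟩
  obtain ⟨t, ht⟩ : ∃ t, t = D⁻¹ := ⟨_, rfl⟩
  obtain ⟨p, hp⟩ : ∃ p, p = -(2 * reDot y.1 a.1 + 2 * reDot y.2 a.2) / S ^ 2 := ⟨_, rfl⟩
  obtain ⟨q, hq⟩ : ∃ q, q = -(2 * reDot y.1 b.1 + 2 * reDot y.2 b.2) / S ^ 2 := ⟨_, rfl⟩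
  have hp' : p = -(2 * reDot y.1 a.1 + 2 * reDot y.2 a.2) * s ^ 2 := by rw [hp, hs]; ring
  have hq' : q = -(2 * reDot y.1 b.1 + 2 * reDot y.2 b.2) * s ^ 2 := by rw [hq, hs]; ring
  have hsS : s * S = 1 := by rw [hs, inv_mul_cancel₀ hS0]
  have htD : t * D = 1 := by rw [ht, inv_mul_cancel₀ hD0.ne']
  rw [← hp, ← hq, ← hs, ← hP, div_eq_mul_inv _ (D * S ^ 2), mul_inv, ← inv_pow, ← hs, ← ht]
  simp only [PiLp.inner_apply, Complex.inner, Fin.sum_univ_two]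
  simp [-Complex.real_smul, Complex.smul_re, Complex.smul_im, reDot, -mul_eq_mul_left_iff,
    -mul_eq_mul_right_iff]
  rw [hp', hq']
  have key := inner_fderiv_fst_aux (pa := 2 * reDot y.1 a.1) (da := 2 * reDot y.2 a.2)
    (pb := 2 * reDot y.1 b.1) (db := 2 * reDot y.2 b.2)
    (nn := (reDot a.1 b.1) * (1 + (y.2.re ^ 2 + y.2.im ^ 2)) +
      reDot a.1 y.1 * reDot y.2 b.2 + (a.1.re * y.1.im - a.1.im * y.1.re) *
        (b.2.im * y.2.re - b.2.re * y.2.im) +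
      reDot b.1 y.1 * reDot y.2 a.2 + (b.1.re * y.1.im - b.1.im * y.1.re) *
        (a.2.im * y.2.re - a.2.re * y.2.im) +
      (y.1.re ^ 2 + y.1.im ^ 2) * reDot a.2 b.2) hsS hSP htD rfl
  simp only [reDot] at key ⊢
  rw [hD', hP'] at key ⊢
  refine Eq.trans ?_ (key.trans ?_) <;> ring

end ModelMap

/-! ### The metric in the coordinates `[z : 1 : w]` -/

section ModelMetric

open ComplexConjugate RealInnerProductSpace

/-- The metric in the coordinates `[z : 1 : w]`. -/
abbrev modelMetric : ℂ × ℂ → (ℂ × ℂ) →L[ℝ] (ℂ × ℂ) →L[ℝ] ℝ := pullbackForm ambientForm modelMap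

/-- The rational expression `k / D² + T / (D S²)` for the metric. -/
def modelExpr (k D S T : ℝ) : ℝ := k / D ^ 2 + T / (D * S ^ 2)

/-- The derivative of `modelExpr` with respect to `D`, `S`, `T` in the direction `D'`, `S'`, `T'`. -/
def modelExprDeriv (k D S T D' S' T' : ℝ) : ℝ :=
  -2 * k * D' / D ^ 3 + T' / (D * S ^ 2) - T * D' / (D ^ 2 * S ^ 2) - 2 * T * S' / (D * S ^ 3)

lemma HasDerivAt.modelExpr {D S T : ℝ → ℝ} {D' S' T' t : ℝ} (k : ℝ) (hD : HasDerivAt D D' t)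
    (hS : HasDerivAt S S' t) (hT : HasDerivAt T T' t) (hD0 : D t ≠ 0) (hS0 : S t ≠ 0) :
    HasDerivAt (fun t => modelExpr k (D t) (S t) (T t))
      (modelExprDeriv k (D t) (S t) (T t) D' S' T') t := by
  have h := ((hasDerivAt_const t k).div (hD.pow 2) (pow_ne_zero 2 hD0)).add
    (hT.div (hD.mul (hS.pow 2)) (mul_ne_zero hD0 (pow_ne_zero 2 hS0)))
  refine h.congr_deriv ?_
  simp [modelExprDeriv]
  field_simp
  ring

/-- Specialised to w = 0, where D = 1 + |w|² equals 1 and has zero differential. Second derivatives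
are needed only there, since the symmetries move every point to w = 0. -/
lemma HasDerivAt.modelExprDeriv {D S T D₁ S₁ T₁ : ℝ → ℝ} {S' T' D₁' S₁' T₁' t : ℝ} (k : ℝ)
    (hD : HasDerivAt D 0 t) (hS : HasDerivAt S S' t) (hT : HasDerivAt T T' t)
    (hD₁ : HasDerivAt D₁ D₁' t) (hS₁ : HasDerivAt S₁ S₁' t) (hT₁ : HasDerivAt T₁ T₁' t)
    (hD0 : D t = 1) (hD₁0 : D₁ t = 0) (hS0 : S t ≠ 0) :
    HasDerivAt (fun t => modelExprDeriv k (D t) (S t) (T t) (D₁ t) (S₁ t) (T₁ t))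
      (-2 * k * D₁' + T₁' / S t ^ 2 - 2 * T₁ t * S' / S t ^ 3 - T t * D₁' / S t ^ 2 -
        2 * T' * S₁ t / S t ^ 3 - 2 * T t * S₁' / S t ^ 3 + 6 * T t * S₁ t * S' / S t ^ 4) t := by
  have hD2 : D t ≠ 0 := by rw [hD0]; exact one_ne_zero
  have h := ((((hD₁.const_mul (-2 * k)).div (hD.pow 3) (pow_ne_zero 3 hD2)).add
    (hT₁.div (hD.mul (hS.pow 2)) (mul_ne_zero hD2 (pow_ne_zero 2 hS0)))).sub
    ((hT.mul hD₁).div ((hD.pow 2).mul (hS.pow 2))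
      (mul_ne_zero (pow_ne_zero 2 hD2) (pow_ne_zero 2 hS0)))).sub
    (((hT.const_mul 2).mul hS₁).div (hD.mul (hS.pow 3)) (mul_ne_zero hD2 (pow_ne_zero 3 hS0)))
  refine h.congr_deriv ?_
  simp [hD0, hD₁0]
  field_simp
  ring

/-- The numerator of the metric. -/
def modelNum (y a b : ℂ × ℂ) : ℝ :=
  reDot (vertical y a) (vertical y b) - 1 / 8 * Complex.normSq y.1 * reDot a.2 b.2

lemma norm_sq_modelMap_fst (y : ℂ × ℂ) :
    ‖(modelMap y).1‖ ^ 2 = Complex.normSq y.1 * (1 + Complex.normSq y.2) /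
      (Complex.normSq y.1 + (1 + Complex.normSq y.2)) ^ 2 := by
  rw [EuclideanSpace.norm_sq_eq]
  simp [modelMap, ambientMap, normSqTail_model, mul_pow, ← Complex.normSq_eq_norm_sq]
  rw [← Complex.ofReal_one, ← Complex.ofReal_add, ← Complex.ofReal_add, Complex.normSq_ofReal]
  have := (add_pos_of_nonneg_of_pos (Complex.normSq_nonneg y.1) (one_add_normSq_pos y.2)).ne'
  field_simp

/-- The horizontal part |z|²/(D S²) of the round metric and the warping -9/8 |x|² = -9/8 |z|² D/S²
combine, leaving the coefficient -1/8 in `modelNum`. -/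
lemma modelMetric_apply (y a b : ℂ × ℂ) :
    modelMetric y a b = modelExpr (reDot a.2 b.2) (1 + Complex.normSq y.2)
      (Complex.normSq y.1 + (1 + Complex.normSq y.2)) (modelNum y a b) := by
  have h1 := inner_fderiv_fst y a b
  have h2 := inner_fderiv_snd y a b
  have hD := (one_add_normSq_pos y.2).ne'
  have hS := (add_pos_of_nonneg_of_pos (Complex.normSq_nonneg y.1) (one_add_normSq_pos y.2)).ne'
  have h3 : modelMetric y a b = _ := pullbackForm_apply _ _ _ _ _
  rw [h3, ambientForm_apply, h1, mul_right_comm, h2, norm_sq_modelMap_fst, modelExpr, modelNum]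
  field_simp
  ring

lemma hasDerivAt_reDot {f g : ℝ → ℂ} {f' g' : ℂ} {t : ℝ} (hf : HasDerivAt f f' t)
    (hg : HasDerivAt g g' t) :
    HasDerivAt (fun t => reDot (f t) (g t)) (reDot f' (g t) + reDot (f t) g') t := by
  have re : ∀ {h : ℝ → ℂ} {h' : ℂ}, HasDerivAt h h' t → HasDerivAt (fun t => (h t).re) h'.re t :=
    fun hh => Complex.reCLM.hasFDerivAt.comp_hasDerivAt t hh
  have im : ∀ {h : ℝ → ℂ} {h' : ℂ}, HasDerivAt h h' t → HasDerivAt (fun t => (h t).im) h'.im t :=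
    fun hh => Complex.imCLM.hasFDerivAt.comp_hasDerivAt t hh
  refine (((re hf).mul (re hg)).add ((im hf).mul (im hg))).congr_deriv ?_
  simp [reDot]
  ring

/-- The derivative of `vertical` in the direction `v`. -/
def verticalDeriv (y v a : ℂ × ℂ) : ℂ :=
  (2 * reDot y.2 v.2 : ℝ) * a.1 - (v.1 * conj y.2 + y.1 * conj v.2) * a.2

/-- The derivative of `modelNum` in the direction `v`. -/
def modelNumDeriv (y v a b : ℂ × ℂ) : ℝ :=
  reDot (verticalDeriv y v a) (vertical y b) + reDot (vertical y a) (verticalDeriv y v b) -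
    1 / 8 * (2 * reDot y.1 v.1) * reDot a.2 b.2

/-- The point `y + t v`. -/
def linePoint (y v : ℂ × ℂ) (t : ℝ) : ℂ × ℂ := (y.1 + (t : ℂ) * v.1, y.2 + (t : ℂ) * v.2)

lemma linePoint_zero (y v : ℂ × ℂ) : linePoint y v 0 = y := by simp [linePoint]

lemma hasDerivAt_linePoint (y v : ℂ × ℂ) : HasDerivAt (linePoint y v) v 0 :=
  (hasDerivAt_line y.1 v.1).prodMk (hasDerivAt_line y.2 v.2)

lemma hasDerivAt_vertical (y v a : ℂ × ℂ) :
    HasDerivAt (fun t => vertical (linePoint y v t) a) (verticalDeriv y v a) 0 := by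
  have hD := ((hasDerivAt_normSq_line y.2 v.2).const_add 1).ofReal_comp
  have h := (hD.mul_const a.1).sub
    (((hasDerivAt_line y.1 v.1).mul (hasDerivAt_conj_line y.2 v.2)).mul_const a.2)
  refine h.congr_deriv ?_
  simp [verticalDeriv, reDot]

lemma hasDerivAt_modelNum (y v a b : ℂ × ℂ) :
    HasDerivAt (fun t => modelNum (linePoint y v t) a b) (modelNumDeriv y v a b) 0 := by
  have h := (hasDerivAt_reDot (hasDerivAt_vertical y v a) (hasDerivAt_vertical y v b)).sub
    (((hasDerivAt_normSq_line y.1 v.1).const_mul (1 / 8)).mul_const (reDot a.2 b.2))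
  refine h.congr_deriv ?_
  simp only [linePoint_zero]
  rfl

lemma contDiff_modelMetric : ContDiff ℝ 2 modelMetric :=
  contDiff_iff_contDiffAt.2 fun _ => ContDiffAt.pullbackForm (m := 3)
    (contDiff_infty.1 contDiff_ambientForm 2) (contDiff_infty.1 contDiff_modelMap 3).contDiffAt
    (by norm_num)

lemma fderiv_modelMetric (y v a b : ℂ × ℂ) :
    fderiv ℝ modelMetric y v a b = modelExprDeriv (reDot a.2 b.2) (1 + Complex.normSq y.2)
      (Complex.normSq y.1 + (1 + Complex.normSq y.2)) (modelNum y a b) (2 * reDot y.2 v.2)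
      (2 * reDot y.1 v.1 + 2 * reDot y.2 v.2) (modelNumDeriv y v a b) := by
  have h1 : HasFDerivAt modelMetric (fderiv ℝ modelMetric y) (linePoint y v 0) := by
    rw [linePoint_zero]
    exact (contDiff_modelMetric.differentiable (by norm_num) y).hasFDerivAt
  have h2 := ((h1.comp_hasDerivAt (0 : ℝ) (hasDerivAt_linePoint y v)).clm_apply
    (hasDerivAt_const 0 a)).clm_apply (hasDerivAt_const 0 b)
  have dD := (hasDerivAt_normSq_line y.2 v.2).const_add 1
  have dS := (hasDerivAt_normSq_line y.1 v.1).add dD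
  have hD := (one_add_normSq_pos (linePoint y v 0).2).ne'
  have hS := (add_pos_of_nonneg_of_pos (Complex.normSq_nonneg (linePoint y v 0).1)
    (one_add_normSq_pos (linePoint y v 0).2)).ne'
  have h3 := HasDerivAt.modelExpr (reDot a.2 b.2) dD dS (hasDerivAt_modelNum y v a b) hD hS
  have h4 := h2.unique (h3.congr_of_eventuallyEq (.of_forall fun t => modelMetric_apply _ _ _))
  simpa [linePoint_zero, reDot] using h4

/-- The second derivative of `vertical` in the directions `u` and `v`. -/
def verticalDeriv2 (u v a : ℂ × ℂ) : ℂ :=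
  (2 * reDot u.2 v.2 : ℝ) * a.1 - (v.1 * conj u.2 + u.1 * conj v.2) * a.2

lemma hasDerivAt_reDot_line (z u v : ℂ) :
    HasDerivAt (fun t : ℝ => 2 * reDot (z + (t : ℂ) * u) v) (2 * reDot u v) 0 := by
  have h := (hasDerivAt_reDot (hasDerivAt_line z u) (hasDerivAt_const (0 : ℝ) v)).const_mul 2
  refine h.congr_deriv ?_
  simp [reDot]

lemma hasDerivAt_verticalDeriv (y u v a : ℂ × ℂ) :
    HasDerivAt (fun t => verticalDeriv (linePoint y u t) v a) (verticalDeriv2 u v a) 0 := by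
  have h := ((hasDerivAt_reDot_line y.2 u.2 v.2).ofReal_comp.mul_const a.1).sub
    ((((hasDerivAt_conj_line y.2 u.2).const_mul v.1).add
      ((hasDerivAt_line y.1 u.1).mul_const (conj v.2))).mul_const a.2)
  exact h

/-- The second derivative of `modelNum` in the directions `u` and `v`. -/
def modelNumDeriv2 (y u v a b : ℂ × ℂ) : ℝ :=
  reDot (verticalDeriv2 u v a) (vertical y b) + reDot (verticalDeriv y v a) (verticalDeriv y u b) +
  (reDot (verticalDeriv y u a) (verticalDeriv y v b) + reDot (vertical y a) (verticalDeriv2 u v b)) -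
    1 / 8 * (2 * reDot u.1 v.1) * reDot a.2 b.2

lemma hasDerivAt_modelNumDeriv (y u v a b : ℂ × ℂ) :
    HasDerivAt (fun t => modelNumDeriv (linePoint y u t) v a b) (modelNumDeriv2 y u v a b) 0 := by
  have h := ((hasDerivAt_reDot (hasDerivAt_verticalDeriv y u v a) (hasDerivAt_vertical y u b)).add
    (hasDerivAt_reDot (hasDerivAt_vertical y u a) (hasDerivAt_verticalDeriv y u v b))).sub
    (((hasDerivAt_reDot_line y.1 u.1 v.1).const_mul (1 / 8)).mul_const (reDot a.2 b.2))
  refine h.congr_deriv ?_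
  simp only [linePoint_zero]
  rfl

/-- The explicit first derivative is differentiated again along the line through (z, 0) in the
direction u. -/
lemma fderiv_fderiv_modelMetric (z : ℂ) (u v a b : ℂ × ℂ) {S T D₁' S₁ S' : ℝ}
    (hS : S = Complex.normSq z + 1) (hT : T = modelNum (z, 0) a b)
    (hD₁' : D₁' = 2 * reDot u.2 v.2) (hS₁ : S₁ = 2 * reDot z v.1) (hS' : S' = 2 * reDot z u.1) :
    fderiv ℝ (fderiv ℝ modelMetric) (z, 0) u v a b =
      -2 * reDot a.2 b.2 * D₁' + modelNumDeriv2 (z, 0) u v a b / S ^ 2 -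
        2 * modelNumDeriv (z, 0) v a b * S' / S ^ 3 - T * D₁' / S ^ 2 -
        2 * modelNumDeriv (z, 0) u a b * S₁ / S ^ 3 -
        2 * T * (2 * reDot u.1 v.1 + D₁') / S ^ 3 + 6 * T * S₁ * S' / S ^ 4 := by
  have h1 : HasFDerivAt (fderiv ℝ modelMetric) (fderiv ℝ (fderiv ℝ modelMetric) (z, 0))
      (linePoint (z, 0) u 0) := by
    rw [linePoint_zero]
    exact ((contDiff_modelMetric.fderiv_right (m := 1) (by norm_num)).differentiable
      (by norm_num) _).hasFDerivAt
  have h2 := (((h1.comp_hasDerivAt (0 : ℝ) (hasDerivAt_linePoint (z, 0) u)).clm_apply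
    (hasDerivAt_const 0 v)).clm_apply (hasDerivAt_const 0 a)).clm_apply (hasDerivAt_const 0 b)
  have dD := (hasDerivAt_normSq_line 0 u.2).const_add 1
  have dS := (hasDerivAt_normSq_line z u.1).add dD
  have dD1 := hasDerivAt_reDot_line 0 u.2 v.2
  have dS1 := (hasDerivAt_reDot_line z u.1 v.1).add dD1
  have h3 := HasDerivAt.modelExprDeriv (reDot a.2 b.2) (dD.congr_deriv (by simp)) dS
    (hasDerivAt_modelNum (z, 0) u a b) dD1 dS1 (hasDerivAt_modelNumDeriv (z, 0) u v a b) (by simp)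
    (by simp [reDot])
    (add_pos_of_nonneg_of_pos (Complex.normSq_nonneg _) (one_add_normSq_pos _)).ne'
  have h4 := h2.unique (h3.congr_of_eventuallyEq
    (.of_forall fun t => fderiv_modelMetric _ _ _ _))
  subst hS hT hD₁' hS₁ hS'
  simp [linePoint_zero, reDot] at h4 ⊢
  rw [h4]

end ModelMetric

/-! ### The curvature of the metric -/

section ModelCurvature

open ComplexConjugate RealInnerProductSpace

lemma isInvertible_of_pos {E : Type*} [NormedAddCommGroup E] [NormedSpace ℝ E]
    [FiniteDimensional ℝ E] {A : E →L[ℝ] E →L[ℝ] ℝ} (hA : ∀ u ≠ 0, 0 < A u u) :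
    A.IsInvertible := by
  have hinj : Function.Injective A := by
    refine (injective_iff_map_eq_zero A).2 fun u hu => ?_
    by_contra h
    exact (hA u h).ne' (by simp [hu])
  have hdim : Module.finrank ℝ E = Module.finrank ℝ (E →L[ℝ] ℝ) := by
    rw [← LinearEquiv.finrank_eq (LinearMap.toContinuousLinearMap : (E →ₗ[ℝ] ℝ) ≃ₗ[ℝ] _)]
    exact (Subspace.dual_finrank_eq (K := ℝ) (V := E)).symm
  exact ⟨(LinearEquiv.ofInjectiveOfFinrankEq (A : E →ₗ[ℝ] E →L[ℝ] ℝ) hinj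
    hdim).toContinuousLinearEquiv, by ext; rfl⟩

lemma modelMetric_symm (y a b : ℂ × ℂ) : modelMetric y a b = modelMetric y b a :=
  ambientForm_symm _ _ _

lemma modelMetric_pos (y a : ℂ × ℂ) (ha : a ≠ 0) : 0 < modelMetric y a a := by
  have hD := one_add_normSq_pos y.2
  have hD1 : 1 ≤ 1 + Complex.normSq y.2 := le_add_of_nonneg_right (Complex.normSq_nonneg _)
  have hP := Complex.normSq_nonneg y.1
  have hself : ∀ z, reDot z z = Complex.normSq z := fun z => (Complex.normSq_apply z).symm
  rw [modelMetric_apply, modelExpr, modelNum, hself, hself]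
  set D := 1 + Complex.normSq y.2
  set P := Complex.normSq y.1
  set V := Complex.normSq (vertical y a) with hV
  set W := Complex.normSq a.2 with hW
  have hV0 : 0 ≤ V := Complex.normSq_nonneg _
  have hW0 : 0 ≤ W := Complex.normSq_nonneg _
  have hS : 0 < P + D := by positivity
  have e : W / D ^ 2 + (V - 1 / 8 * P * W) / (D * (P + D) ^ 2) =
      (W * ((P + D) ^ 2 - 1 / 8 * P * D) + V * D) / (D ^ 2 * (P + D) ^ 2) := by
    field_simp
    ring
  rw [e]
  -- The horizontal coefficient stays positive because 1/8 is well below the 4 in (P + D)² ≥ 4 P D.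
  have h1 : 0 < (P + D) ^ 2 - 1 / 8 * P * D := by nlinarith [mul_nonneg hP hD.le]
  refine div_pos ?_ (by positivity)
  by_cases hw : a.2 = 0
  · have hz : a.1 ≠ 0 := fun hz => ha (Prod.ext hz hw)
    have hV1 : 0 < V := by
      rw [hV, Complex.normSq_pos, vertical, hw, mul_zero, sub_zero]
      exact mul_ne_zero (Complex.ofReal_ne_zero.2 hD.ne') hz
    have := mul_pos hV1 hD
    have := mul_nonneg hW0 h1.le
    linarith
  · have : 0 < W := Complex.normSq_pos.2 hw
    have := mul_pos this h1
    have := mul_nonneg hV0 hD.le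
    linarith

lemma isLocalMetricAt_modelMetric (y : ℂ × ℂ) : IsLocalMetricAt modelMetric y :=
  ⟨contDiff_modelMetric.contDiffAt, .of_forall fun z a b => modelMetric_symm z a b,
    isInvertible_of_pos fun u hu => modelMetric_pos y u hu⟩

/-- The Christoffel symbols at the point `(r, 0)`, where `S = 1 + r²`. -/
def modelChristoffel (r S : ℝ) (u v : ℂ × ℂ) : ℂ × ℂ :=
  (⟨(-r * reDot u.2 v.2 + r * reDot u.2 v.2 / 8 - 4 * r * u.1.re * v.1.re / S +
        2 * r * (reDot u.1 v.1 - r ^ 2 / 8 * reDot u.2 v.2) / S),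
      -2 * r / S * (u.1.re * v.1.im + v.1.re * u.1.im)⟩,
    ((4 * S ^ 2 / (8 * S ^ 2 - r ^ 2) : ℝ) : ℂ) *
      (⟨0, -2 * r / S ^ 2⟩ * ((v.1.im : ℂ) * u.2 + (u.1.im : ℂ) * v.2) +
      ((-r / (4 * S ^ 2) + r ^ 3 / (2 * S ^ 3) : ℝ) : ℂ) *
        ((u.1.re : ℂ) * v.2 + (v.1.re : ℂ) * u.2)))

/-- At w = 0 the horizontal and vertical directions are the two coordinate planes, hence the
diagonal form. -/
lemma modelMetric_base (r : ℝ) (a b : ℂ × ℂ) {S : ℝ} (hS : S = 1 + r ^ 2) :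
    modelMetric ((r : ℂ), 0) a b =
      reDot a.1 b.1 / S ^ 2 + (1 - r ^ 2 / (8 * S ^ 2)) * reDot a.2 b.2 := by
  have hS' : Complex.normSq (r : ℂ) + (1 + Complex.normSq 0) = S := by
    rw [hS, Complex.normSq_ofReal, map_zero]
    ring
  rw [modelMetric_apply, hS', modelExpr, modelNum]
  simp [vertical, Complex.normSq_ofReal]
  ring

lemma fderiv_modelMetric_base (r : ℝ) (v a b : ℂ × ℂ) {S : ℝ} (hS : S = 1 + r ^ 2) :
    fderiv ℝ modelMetric ((r : ℂ), 0) v a b =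
      (-r * (reDot (conj v.2 * a.2) b.1 + reDot a.1 (conj v.2 * b.2)) -
        r * v.1.re / 4 * reDot a.2 b.2) / S ^ 2 -
      4 * r * v.1.re * (reDot a.1 b.1 - r ^ 2 / 8 * reDot a.2 b.2) / S ^ 3 := by
  have hS' : Complex.normSq (r : ℂ) + (1 + Complex.normSq 0) = S := by
    rw [hS, Complex.normSq_ofReal, map_zero]
    ring
  rw [fderiv_modelMetric, hS', modelExprDeriv, modelNum, modelNumDeriv]
  simp [vertical, verticalDeriv, Complex.normSq_ofReal, reDot]
  ring

/-- By nondegeneracy the formula is checked after pairing with an arbitrary vector, against the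
Koszul expression; no inverse matrix is computed. -/
lemma christoffel_modelMetric (r : ℝ) (u v : ℂ × ℂ) {S : ℝ} (hS : S = 1 + r ^ 2) :
    christoffel modelMetric ((r : ℂ), 0) u v = modelChristoffel r S u v := by
  refine (isLocalMetricAt_modelMetric ((r : ℂ), 0)).eq_of_apply_eq fun x => ?_
  rw [(isLocalMetricAt_modelMetric ((r : ℂ), 0)).apply_christoffel, koszulL_apply, modelMetric_base r _ _ hS]
  simp only [fderiv_modelMetric_base r _ _ _ hS]
  have hS0 : S ≠ 0 := by rw [hS]; positivity
  have hB : 8 * S ^ 2 - r ^ 2 ≠ 0 := by rw [hS]; nlinarith [sq_nonneg r]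
  have e : (1 - r ^ 2 / (8 * S ^ 2)) * (4 * S ^ 2 / (8 * S ^ 2 - r ^ 2)) = 1 / 2 := by
    field_simp
    ring
  simp only [modelChristoffel]
  -- The metric coefficient A and k = 1/(2A) become atoms linked only by A k = 1/2. Once the
  -- products A k are eliminated, powers of S are the only remaining denominators.
  generalize 4 * S ^ 2 / (8 * S ^ 2 - r ^ 2) = k at e ⊢
  generalize 1 - r ^ 2 / (8 * S ^ 2) = A at e ⊢
  simp only [reDot, Complex.add_re, Complex.add_im, Complex.mul_re, Complex.mul_im,
    Complex.ofReal_re, Complex.ofReal_im, Complex.conj_re, Complex.conj_im]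
  linear_combination (norm := skip) (-(
    (-2 * r / S ^ 2 * -(v.1.im * u.2.im + u.1.im * v.2.im) +
      (-r / (4 * S ^ 2) + r ^ 3 / (2 * S ^ 3)) * (u.1.re * v.2.re + v.1.re * u.2.re)) * x.2.re +
    (-2 * r / S ^ 2 * (v.1.im * u.2.re + u.1.im * v.2.re) +
      (-r / (4 * S ^ 2) + r ^ 3 / (2 * S ^ 3)) * (u.1.re * v.2.im + v.1.re * u.2.im)) * x.2.im)) * e
  clear e hB
  field_simp
  ring

end ModelCurvature

/-! ### Second derivatives and sectional curvature at [r : 1 : 0] -/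

section ModelSectional

open ComplexConjugate RealInnerProductSpace

/-- The second derivative of the metric at the point `(r, 0)`, where `S = 1 + r²`. -/
lemma fderiv_fderiv_modelMetric_base (r : ℝ) (u v a b : ℂ × ℂ) {S : ℝ} (hS : S = 1 + r ^ 2) :
    fderiv ℝ (fderiv ℝ modelMetric) ((r : ℂ), 0) u v a b =
      -4 * reDot a.2 b.2 * reDot u.2 v.2 +
      (2 * reDot u.2 v.2 * reDot a.1 b.1 * 2 -
        reDot ((v.1 * conj u.2 + u.1 * conj v.2) * a.2) b.1 -
        reDot a.1 ((v.1 * conj u.2 + u.1 * conj v.2) * b.2) +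
        r ^ 2 * reDot (conj v.2 * a.2) (conj u.2 * b.2) +
        r ^ 2 * reDot (conj u.2 * a.2) (conj v.2 * b.2) -
        reDot u.1 v.1 * reDot a.2 b.2 / 4 -
        2 * (reDot a.1 b.1 - r ^ 2 / 8 * reDot a.2 b.2) * reDot u.2 v.2) / S ^ 2 +
      (4 * r ^ 2 * u.1.re * (reDot (conj v.2 * a.2) b.1 + reDot a.1 (conj v.2 * b.2) +
          v.1.re / 4 * reDot a.2 b.2) +
        4 * r ^ 2 * v.1.re * (reDot (conj u.2 * a.2) b.1 + reDot a.1 (conj u.2 * b.2) +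
          u.1.re / 4 * reDot a.2 b.2) -
        4 * (reDot a.1 b.1 - r ^ 2 / 8 * reDot a.2 b.2) * (reDot u.1 v.1 + reDot u.2 v.2)) / S ^ 3 +
      24 * r ^ 2 * u.1.re * v.1.re * (reDot a.1 b.1 - r ^ 2 / 8 * reDot a.2 b.2) / S ^ 4 := by
  have hS' : S = Complex.normSq (r : ℂ) + 1 := by
    rw [hS, Complex.normSq_ofReal]
    ring
  rw [fderiv_fderiv_modelMetric (r : ℂ) u v a b hS' rfl rfl rfl rfl]
  simp only [modelNumDeriv2, modelNumDeriv, modelNum, verticalDeriv2, verticalDeriv, vertical,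
    reDot, Complex.normSq_apply, Complex.add_re, Complex.add_im, Complex.sub_re, Complex.sub_im,
    Complex.mul_re, Complex.mul_im,
    Complex.ofReal_re, Complex.ofReal_im, Complex.conj_re, Complex.conj_im, Complex.zero_re,
    Complex.zero_im, map_zero]
  ring

/-- The curvature of the metric at `(r, 0)`, in terms of the Plücker coordinates of the plane. -/
def modelCurvature (r S A P12 P13 P14 P23 P24 P34 : ℝ) : ℝ :=
  4 / S ^ 4 * P12 ^ 2 +
  (4 * A - 3 * r ^ 2 / S ^ 2 - r ^ 2 * (1 - r ^ 2) ^ 2 / (64 * S ^ 4)) * P34 ^ 2 +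
  (((1 - r ^ 2) ^ 2 - 4 * r ^ 2) / 8 + r ^ 2 * (1 - r ^ 2) ^ 2 / (64 * A * S ^ 2)) / S ^ 4 *
    (P13 ^ 2 + P14 ^ 2) +
  (r ^ 2 / A + (1 - r ^ 2) ^ 2 / 8) / S ^ 4 * (P23 ^ 2 + P24 ^ 2) +
  6 * (1 - r ^ 2) / (A * S ^ 3) * P12 * P34

/-- The isometries w ↦ e^{iθ} w and complex conjugation fix the point (r, 0), so the only mixed
terms possible are P12 P34 and P13 P24 - P14 P23. These two are equal by the Plücker relation, which
is why one mixed term suffices in `modelCurvature`. -/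
lemma modelMetric_localRiemann (r : ℝ) (u v : ℂ × ℂ) {S A : ℝ} (hS : S = 1 + r ^ 2)
    (hA : A = 1 - r ^ 2 / (8 * S ^ 2)) :
    modelMetric ((r : ℂ), 0) (localRiemann modelMetric ((r : ℂ), 0) u v v) u =
      modelCurvature r S A (u.1.re * v.1.im - u.1.im * v.1.re) (u.1.re * v.2.re - u.2.re * v.1.re)
        (u.1.re * v.2.im - u.2.im * v.1.re) (u.1.im * v.2.re - u.2.re * v.1.im)
        (u.1.im * v.2.im - u.2.im * v.1.im) (u.2.re * v.2.im - u.2.im * v.2.re) := by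
  rw [(isLocalMetricAt_modelMetric ((r : ℂ), 0)).apply_localRiemann]
  simp only [koszulL_apply, fderiv_fderiv_modelMetric_base r _ _ _ _ hS,
    christoffel_modelMetric r _ _ hS, modelMetric_base r _ _ hS]
  have hS0 : S ≠ 0 := by rw [hS]; positivity
  have hB : 8 * S ^ 2 - r ^ 2 ≠ 0 := by rw [hS]; nlinarith [sq_nonneg r]
  have e : A = (8 * S ^ 2 - r ^ 2) / (8 * S ^ 2) := by
    rw [hA]
    field_simp
  rw [← hA, e]
  clear hA e
  -- With A = B/(8S²), all denominators are powers of the atoms S and B; both are expanded in r only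
  -- after clearing them.
  obtain ⟨B, hBe⟩ : ∃ B, B = 8 * S ^ 2 - r ^ 2 := ⟨_, rfl⟩
  rw [← hBe] at hB
  simp only [modelChristoffel, modelCurvature, ← hBe]
  obtain ⟨⟨u1, u2⟩, ⟨u3, u4⟩⟩ := u
  obtain ⟨⟨v1, v2⟩, ⟨v3, v4⟩⟩ := v
  simp only [reDot, Complex.add_re, Complex.add_im, Complex.mul_re, Complex.mul_im,
    Complex.conj_re, Complex.conj_im, Complex.ofReal_re, Complex.ofReal_im]
  field_simp
  subst hBe
  subst hS
  ring

end ModelSectional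

/-! ### Positivity of the biorthogonal curvature -/

section ModelPositive

/-- The Plücker coordinates of the plane spanned by `u` and `v`. -/
def plucker (u v : Fin 4 → ℝ) (i j : Fin 4) : ℝ := u i * v j - u j * v i

/-- The Plücker coordinates of a plane in `ℝ⁴` are, up to a factor, the complementary Plücker
coordinates of its annihilator. -/
lemma exists_plucker_eq {p q w x : Fin 4 → ℝ} (hpw : ∑ i, p i * w i = 0) (hpx : ∑ i, p i * x i = 0)
    (hqw : ∑ i, q i * w i = 0) (hqx : ∑ i, q i * x i = 0)
    (hpq : ∃ i j, plucker p q i j ≠ 0) :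
    ∃ t : ℝ, plucker w x 0 1 = t * plucker p q 2 3 ∧ plucker w x 0 2 = t * -plucker p q 1 3 ∧
      plucker w x 0 3 = t * plucker p q 1 2 ∧ plucker w x 1 2 = t * plucker p q 0 3 ∧
      plucker w x 1 3 = t * -plucker p q 0 2 ∧ plucker w x 2 3 = t * plucker p q 0 1 := by
  -- The product of the skew matrices of w ∧ x and p ∧ q vanishes because p and q annihilate w and
  -- x. Everything else follows from these sixteen equations.
  have row : ∀ i l, ∑ j, plucker w x i j * plucker p q j l = 0 := fun i l => by
    simp only [Fin.sum_univ_four, plucker] at *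
    linear_combination (w i * q l) * hpx - (x i * q l) * hpw - (w i * p l) * hqx +
      (x i * p l) * hqw
  have anti : ∀ (a b : Fin 4 → ℝ) i j, plucker a b i j = -plucker a b j i := fun a b i j => by
    simp only [plucker]
    ring
  have diag : ∀ (a b : Fin 4 → ℝ) i, plucker a b i i = 0 := fun a b i => by
    simp only [plucker]
    ring
  set N := plucker p q 0 1 ^ 2 + plucker p q 0 2 ^ 2 + plucker p q 0 3 ^ 2 +
    plucker p q 1 2 ^ 2 + plucker p q 1 3 ^ 2 + plucker p q 2 3 ^ 2 with hN
  have hN0 : N ≠ 0 := by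
    intro h
    obtain ⟨i, j, hij⟩ := hpq
    have h01 : plucker p q 0 1 = 0 := by nlinarith
    have h02 : plucker p q 0 2 = 0 := by nlinarith
    have h03 : plucker p q 0 3 = 0 := by nlinarith
    have h12 : plucker p q 1 2 = 0 := by nlinarith
    have h13 : plucker p q 1 3 = 0 := by nlinarith
    have h23 : plucker p q 2 3 = 0 := by nlinarith
    apply hij
    fin_cases i <;> fin_cases j <;>
      simp [h01, h02, h03, h12, h13, h23, diag, anti p q 1 0, anti p q 2 0, anti p q 3 0,
        anti p q 2 1, anti p q 3 1, anti p q 3 2]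
  simp only [Fin.sum_univ_four] at row
  -- The factor t is that of the orthogonal projection of w ∧ x to the line spanned by the Hodge
  -- star of p ∧ q.
  refine ⟨(plucker w x 0 1 * plucker p q 2 3 - plucker w x 0 2 * plucker p q 1 3 +
    plucker w x 0 3 * plucker p q 1 2 + plucker w x 1 2 * plucker p q 0 3 -
    plucker w x 1 3 * plucker p q 0 2 + plucker w x 2 3 * plucker p q 0 1) / N, ?_⟩
  have r00 := row 0 0
  have r01 := row 0 1
  have r02 := row 0 2
  have r03 := row 0 3
  have r10 := row 1 0
  have r11 := row 1 1
  have r12 := row 1 2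
  have r13 := row 1 3
  have r20 := row 2 0
  have r21 := row 2 1
  have r22 := row 2 2
  have r23 := row 2 3
  have r30 := row 3 0
  have r31 := row 3 1
  have r32 := row 3 2
  have r33 := row 3 3
  simp only [diag, anti w x 1 0, anti w x 2 0, anti w x 3 0, anti w x 2 1, anti w x 3 1,
    anti w x 3 2, anti p q 1 0, anti p q 2 0, anti p q 3 0, anti p q 2 1, anti p q 3 1,
    anti p q 3 2] at r00 r01 r02 r03 r10 r11 r12 r13 r20 r21 r22 r23 r30 r31 r32 r33
  clear row hpw hpx hqw hqx hpq
  clear_value N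
  generalize plucker w x 0 1 = Q01 at *
  generalize plucker w x 0 2 = Q02 at *
  generalize plucker w x 0 3 = Q03 at *
  generalize plucker w x 1 2 = Q12 at *
  generalize plucker w x 1 3 = Q13 at *
  generalize plucker w x 2 3 = Q23 at *
  generalize plucker p q 0 1 = R01 at *
  generalize plucker p q 0 2 = R02 at *
  generalize plucker p q 0 3 = R03 at *
  generalize plucker p q 1 2 = R12 at *
  generalize plucker p q 1 3 = R13 at *
  generalize plucker p q 2 3 = R23 at *
  -- Signed half-sums of the diagonal entries of the matrix product.
  have d1 : Q01 * R01 = Q23 * R23 := by linear_combination (-r00 - r11 + r22 + r33) / 2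
  have d2 : Q02 * R02 = Q13 * R13 := by linear_combination (-r00 - r22 + r11 + r33) / 2
  have d3 : Q03 * R03 = Q12 * R12 := by linear_combination (-r00 - r33 + r11 + r22) / 2
  refine ⟨?_, ?_, ?_, ?_, ?_, ?_⟩ <;> rw [div_mul_eq_mul_div, eq_div_iff hN0, hN]
  · linear_combination R01 * d1 + R13 * r03 + R12 * r02 - R03 * r13 - R02 * r12
  · linear_combination R02 * d2 + R23 * r03 - R12 * r01 - R03 * r23 - R01 * r21
  · linear_combination R03 * d3 - R23 * r02 - R13 * r01 - R02 * r32 - R01 * r31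
  · linear_combination -R12 * d3 + R23 * r13 - R13 * r23 - R02 * r10 + R01 * r20
  · linear_combination -R13 * d2 - R23 * r12 - R12 * r32 - R03 * r10 + R01 * r30
  · linear_combination -R23 * d1 - R13 * r21 + R12 * r31 - R03 * r20 + R02 * r30

/-- The Gram determinant of the metric at `(r, 0)` in terms of the Plücker coordinates. -/
def modelArea (S A P12 P13 P14 P23 P24 P34 : ℝ) : ℝ :=
  P12 ^ 2 / S ^ 4 + A ^ 2 * P34 ^ 2 + A / S ^ 2 * (P13 ^ 2 + P14 ^ 2 + P23 ^ 2 + P24 ^ 2)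

/-- The star operator exchanges the normalised P12 and P34, and the pairs 13, 24 and 14, 23. The sum
thus has the same coefficient β on both squares of the first pair and a common coefficient α on the
other four coordinates; what is needed is α > 0 and that β exceeds the mixed coefficient 6|c| ≤ 6.
The factor S⁴/A² is the inverse determinant of the metric. -/
lemma modelCurvature_add_dual_pos {r S A P12 P13 P14 P23 P24 P34 : ℝ} (hS : S = 1 + r ^ 2)
    (hA : A = 1 - r ^ 2 / (8 * S ^ 2))
    (hP : 0 < modelArea S A P12 P13 P14 P23 P24 P34) :
    0 < modelCurvature r S A P12 P13 P14 P23 P24 P34 +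
      modelCurvature r S A (A ^ 2 * P34) (-(A / S ^ 2 * P24)) (A / S ^ 2 * P23)
        (A / S ^ 2 * P14) (-(A / S ^ 2 * P13)) (P12 / S ^ 4) * (S ^ 4 / A ^ 2) := by
  have hS0 : 0 < S := by rw [hS]; positivity
  -- X is |x|² and c is minus the height at this point; c² + 4X = 1 is the equation of the sphere of
  -- radius 1/2.
  obtain ⟨X, hX⟩ : ∃ X, X = r ^ 2 / S ^ 2 := ⟨_, rfl⟩
  obtain ⟨c, hc⟩ : ∃ c, c = (1 - r ^ 2) / S := ⟨_, rfl⟩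
  have hX0 : 0 ≤ X := by rw [hX]; positivity
  have hcX : c ^ 2 = 1 - 4 * X := by
    rw [hc, hX]
    field_simp
    rw [hS]
    ring
  have hAX : A = 1 - X / 8 := by
    rw [hA, hX]
    field_simp
  have hX1 : X ≤ 1 / 4 := by nlinarith [sq_nonneg c]
  have hA0 : 0 < A := by linarith
  have hA1 : A ≤ 1 := by linarith
  obtain ⟨β, hβ⟩ : ∃ β, β = 4 * A - 3 * X - X * c ^ 2 / 64 + 4 * A ^ 2 := ⟨_, rfl⟩
  have hβ6 : 6 < β := by
    rw [hβ, hcX, hAX]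
    nlinarith
  obtain ⟨α, hα⟩ : ∃ α, α = (c ^ 2 - 4 * X) / 8 + X * c ^ 2 / (64 * A) + (X / A + c ^ 2 / 8) :=
    ⟨_, rfl⟩
  have hα0 : 0 < α := by
    -- This bounds α below by 1/4 - X/2 ≥ 1/8. With no excess over 1 in the coefficient 9/8 only X/A
    -- would remain, which is zero at r = 0.
    have h1 : X ≤ X / A := le_div_self hX0 hA0 hA1
    have h2 : 0 ≤ X * c ^ 2 / (64 * A) := by positivity
    rw [hα]
    linarith
  -- With a = P12/(S²A) and b = P34, the form β(a² + b²) + 12 c a b is split using a² + b² + 2 c a b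
  -- = (a + c b)² + (1 - c²) b², where 1 - c² = 4X.
  have e : modelCurvature r S A P12 P13 P14 P23 P24 P34 +
      modelCurvature r S A (A ^ 2 * P34) (-(A / S ^ 2 * P24)) (A / S ^ 2 * P23)
        (A / S ^ 2 * P14) (-(A / S ^ 2 * P13)) (P12 / S ^ 4) * (S ^ 4 / A ^ 2) =
      (β - 6) * ((P12 / (S ^ 2 * A)) ^ 2 + P34 ^ 2) +
      6 * ((P12 / (S ^ 2 * A) + c * P34) ^ 2 + 4 * X * P34 ^ 2) +
      α / S ^ 2 * (P13 ^ 2 + P14 ^ 2 + P23 ^ 2 + P24 ^ 2) := by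
    have hX4 : 4 * X = 1 - c ^ 2 := by linarith
    rw [hX4, hβ, hα, hX, hc, modelCurvature, modelCurvature]
    field_simp
    ring
  rw [e]
  have h1 : 0 ≤ (P12 / (S ^ 2 * A)) ^ 2 + P34 ^ 2 := by positivity
  have h2 : 0 ≤ (P12 / (S ^ 2 * A) + c * P34) ^ 2 + 4 * X * P34 ^ 2 := by positivity
  have h3 : 0 ≤ P13 ^ 2 + P14 ^ 2 + P23 ^ 2 + P24 ^ 2 := by positivity
  have hαS : 0 < α / S ^ 2 := by positivity
  have hβ0 : 0 < β - 6 := by linarith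
  rcases h3.lt_or_eq with h3' | h3'
  · have := mul_pos hαS h3'
    positivity
  · have h1' : 0 < (P12 / (S ^ 2 * A)) ^ 2 + P34 ^ 2 := by
      by_contra h
      obtain ⟨h12, h34⟩ := (add_eq_zero_iff_of_nonneg (sq_nonneg _) (sq_nonneg _)).1
        (le_antisymm (not_lt.1 h) h1)
      replace h12 := pow_eq_zero_iff two_ne_zero |>.1 h12
      replace h34 := pow_eq_zero_iff two_ne_zero |>.1 h34
      have h12' : P12 = 0 := (div_eq_zero_iff.1 h12).resolve_right (by positivity)
      rw [modelArea, ← h3', h34, h12'] at hP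
      simp at hP
    have := mul_pos hβ0 h1'
    positivity

/-- If all 2×2 minors vanish, each coordinate gives a linear relation between the two vectors, so
all coordinates of the first vanish. -/
lemma plucker_ne_zero_of_linearIndependent {V : Type*} [AddCommGroup V] [Module ℝ V]
    (f : V →ₗ[ℝ] Fin 4 → ℝ) (hf : Function.Injective f) {b : Fin 2 → V}
    (hb : LinearIndependent ℝ b) : ∃ i j, plucker (f (b 0)) (f (b 1)) i j ≠ 0 := by
  by_contra! h
  have key : ∀ i, f (b 1) i • b 0 - f (b 0) i • b 1 = 0 := fun i => by
    apply hf
    rw [map_sub, map_smul, map_smul, map_zero]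
    ext j
    have := h j i
    simp only [plucker] at this
    simp only [Pi.sub_apply, Pi.smul_apply, smul_eq_mul, Pi.zero_apply]
    linear_combination this
  replace hb : LinearIndependent ℝ ![b 0, b 1] := by
    convert hb using 1
    ext i
    fin_cases i <;> rfl
  rw [LinearIndependent.pair_iff] at hb
  have h0 : f (b 0) = 0 := funext fun i =>
    neg_eq_zero.1 (hb (f (b 1) i) (-f (b 0) i) (by rw [neg_smul, ← sub_eq_add_neg]; exact key i)).2
  have h1 : b 0 = 0 := hf (by rw [h0, map_zero])
  exact one_ne_zero (hb 1 0 (by rw [h1]; simp)).1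

/-- The real coordinates of `ℂ × ℂ`. -/
def realCoords : (ℂ × ℂ) →ₗ[ℝ] Fin 4 → ℝ where
  toFun a := ![a.1.re, a.1.im, a.2.re, a.2.im]
  map_add' a b := by
    ext i
    fin_cases i <;> simp
  map_smul' t a := by
    ext i
    fin_cases i <;> simp

lemma realCoords_injective : Function.Injective realCoords := fun _ _ h =>
  Prod.ext (Complex.ext (congrFun h 0) (congrFun h 1)) (Complex.ext (congrFun h 2) (congrFun h 3))

lemma modelArea_eq (r : ℝ) (u v : ℂ × ℂ) {S A : ℝ} (hS : S = 1 + r ^ 2)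
    (hA : A = 1 - r ^ 2 / (8 * S ^ 2)) :
    modelMetric ((r : ℂ), 0) u u * modelMetric ((r : ℂ), 0) v v -
      modelMetric ((r : ℂ), 0) u v ^ 2 =
      modelArea S A (u.1.re * v.1.im - u.1.im * v.1.re) (u.1.re * v.2.re - u.2.re * v.1.re)
        (u.1.re * v.2.im - u.2.im * v.1.re) (u.1.im * v.2.re - u.2.re * v.1.im)
        (u.1.im * v.2.im - u.2.im * v.1.im) (u.2.re * v.2.im - u.2.im * v.2.re) := by
  have hS0 : S ≠ 0 := by rw [hS]; positivity
  simp only [modelMetric_base r _ _ hS, ← hA, modelArea, reDot]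
  field_simp
  ring

lemma modelArea_pos {S A P12 P13 P14 P23 P24 P34 : ℝ} (hS : 0 < S) (hA : 0 < A)
    (h : P12 ≠ 0 ∨ P13 ≠ 0 ∨ P14 ≠ 0 ∨ P23 ≠ 0 ∨ P24 ≠ 0 ∨ P34 ≠ 0) :
    0 < modelArea S A P12 P13 P14 P23 P24 P34 := by
  unfold modelArea
  rcases h with h | h | h | h | h | h <;> positivity

lemma exists_plucker_ne_zero {u v : Fin 4 → ℝ} {i j : Fin 4} (h : plucker u v i j ≠ 0) :
    plucker u v 0 1 ≠ 0 ∨ plucker u v 0 2 ≠ 0 ∨ plucker u v 0 3 ≠ 0 ∨ plucker u v 1 2 ≠ 0 ∨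
      plucker u v 1 3 ≠ 0 ∨ plucker u v 2 3 ≠ 0 := by
  by_contra! h'
  obtain ⟨h01, h02, h03, h12, h13, h23⟩ := h'
  simp only [plucker, sub_eq_zero] at *
  apply h
  fin_cases i <;> fin_cases j <;> simp [h01, h02, h03, h12, h13, h23]

/-- Curvature and area are both quadratic in the Plücker coordinates, so the factor t cancels. The
star multiplies the area by the determinant A²/S⁴, and the two fractions get a common denominator.
-/
lemma add_div_pos_of_dual {r S A P12 P13 P14 P23 P24 P34 Q12 Q13 Q14 Q23 Q24 Q34 t : ℝ}
    (hS : 0 < S) (hA : 0 < A) (hP : 0 < modelArea S A P12 P13 P14 P23 P24 P34)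
    (hQ : 0 < modelArea S A Q12 Q13 Q14 Q23 Q24 Q34)
    (h : 0 < modelCurvature r S A P12 P13 P14 P23 P24 P34 +
      modelCurvature r S A (A ^ 2 * P34) (-(A / S ^ 2 * P24)) (A / S ^ 2 * P23)
        (A / S ^ 2 * P14) (-(A / S ^ 2 * P13)) (P12 / S ^ 4) * (S ^ 4 / A ^ 2))
    (h12 : Q12 = t * (A ^ 2 * P34)) (h13 : Q13 = t * -(A / S ^ 2 * P24))
    (h14 : Q14 = t * (A / S ^ 2 * P23)) (h23 : Q23 = t * (A / S ^ 2 * P14))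
    (h24 : Q24 = t * -(A / S ^ 2 * P13)) (h34 : Q34 = t * (P12 / S ^ 4)) :
    0 < modelCurvature r S A P12 P13 P14 P23 P24 P34 / modelArea S A P12 P13 P14 P23 P24 P34 +
      modelCurvature r S A Q12 Q13 Q14 Q23 Q24 Q34 / modelArea S A Q12 Q13 Q14 Q23 Q24 Q34 := by
  have eQ : modelArea S A Q12 Q13 Q14 Q23 Q24 Q34 =
      t ^ 2 * (A ^ 2 / S ^ 4) * modelArea S A P12 P13 P14 P23 P24 P34 := by
    rw [h12, h13, h14, h23, h24, h34, modelArea, modelArea]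
    field_simp
    ring
  have eN : ∀ x1 x2 x3 x4 x5 x6, modelCurvature r S A (t * x1) (t * x2) (t * x3) (t * x4) (t * x5)
      (t * x6) = t ^ 2 * modelCurvature r S A x1 x2 x3 x4 x5 x6 := fun x1 x2 x3 x4 x5 x6 => by
    simp only [modelCurvature]
    ring
  have ht : t ≠ 0 := fun ht => hQ.ne' (by rw [eQ, ht]; ring)
  rw [eQ, h12, h13, h14, h23, h24, h34, eN]
  set N := modelCurvature r S A P12 P13 P14 P23 P24 P34
  set N' := modelCurvature r S A (A ^ 2 * P34) (-(A / S ^ 2 * P24)) (A / S ^ 2 * P23)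
        (A / S ^ 2 * P14) (-(A / S ^ 2 * P13)) (P12 / S ^ 4)
  set a := modelArea S A P12 P13 P14 P23 P24 P34
  have e : N / a + t ^ 2 * N' / (t ^ 2 * (A ^ 2 / S ^ 4) * a) = (N + N' * (S ^ 4 / A ^ 2)) / a := by
    field_simp
  rw [e]
  exact div_pos h hP

lemma posBiorthAt_modelMetric (r : ℝ) : PosBiorthAt modelMetric ((r : ℂ), 0) := by
  intro b c hb hc hbc
  obtain ⟨S, hS⟩ : ∃ S, S = 1 + r ^ 2 := ⟨_, rfl⟩
  obtain ⟨A, hA⟩ : ∃ A, A = 1 - r ^ 2 / (8 * S ^ 2) := ⟨_, rfl⟩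
  have hS0 : 0 < S := by rw [hS]; positivity
  have hA0 : 0 < A := by
    rw [hA, sub_pos, div_lt_one (by positivity), hS]
    nlinarith [sq_nonneg r]
  -- The diagonal of the metric. Multiplying by it turns b into covectors, which annihilate c in the
  -- Euclidean sense, as `exists_plucker_eq` requires.
  let d : Fin 4 → ℝ := ![(S ^ 2)⁻¹, (S ^ 2)⁻¹, A, A]
  have hd : ∀ i, d i ≠ 0 := fun i => by fin_cases i <;> simp [d, hS0.ne', hA0.ne']
  have hpc : ∀ i j, ∑ k, d k * realCoords (b i) k * realCoords (c j) k = 0 := fun i j => by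
    have := hbc i j
    rw [modelMetric_base r _ _ hS, ← hA, reDot, reDot] at this
    simp [Fin.sum_univ_four, d, realCoords]
    linear_combination this
  have hb' : ∀ i j, plucker (fun k => d k * realCoords (b 0) k)
      (fun k => d k * realCoords (b 1) k) i j =
      d i * d j * plucker (realCoords (b 0)) (realCoords (b 1)) i j := fun i j => by
    simp only [plucker]
    ring
  obtain ⟨i, j, hij⟩ := plucker_ne_zero_of_linearIndependent _ realCoords_injective hb
  obtain ⟨t, e01, e02, e03, e12, e13, e23⟩ := exists_plucker_eq (hpc 0 0) (hpc 0 1) (hpc 1 0)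
    (hpc 1 1) ⟨i, j, hb' i j ▸ mul_ne_zero (mul_ne_zero (hd i) (hd j)) hij⟩
  obtain ⟨i', j', hij'⟩ := plucker_ne_zero_of_linearIndependent _ realCoords_injective hc
  have hareab := modelArea_pos hS0 hA0 (exists_plucker_ne_zero hij)
  have hareac := modelArea_pos hS0 hA0 (exists_plucker_ne_zero hij')
  have d0 : d 0 = (S ^ 2)⁻¹ := rfl
  have d1 : d 1 = (S ^ 2)⁻¹ := rfl
  have d2 : d 2 = A := rfl
  have d3 : d 3 = A := rfl
  simp only [hb', d0, d1, d2, d3] at e01 e02 e03 e12 e13 e23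
  have key := add_div_pos_of_dual hS0 hA0 hareab hareac (modelCurvature_add_dual_pos hS hA hareab)
    (e01.trans (by ring)) (e02.trans (by ring)) (e03.trans (by ring)) (e12.trans (by ring))
    (e13.trans (by ring)) (e23.trans (by ring))
  rw [localSec, localSec, modelArea_eq r _ _ hS hA, modelArea_eq r _ _ hS hA,
    modelMetric_localRiemann r (b 0) (b 1) hS hA, modelMetric_localRiemann r (c 0) (c 1) hS hA]
  exact key

end ModelPositive

/-! ### The metric in affine coordinates -/

section AffineCoordinates

open ComplexConjugate

/-- The map to the ambient space in affine coordinates. -/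
def affineMap (s : ℝ) (i : Fin 3) (y : ModelC2) : Ambient := ambientMap s (CP.homog i y)

lemma contDiffAt_affineMap (s : ℝ) {i : Fin 3} {y : ModelC2} (hy : normSqTail (CP.homog i y) ≠ 0) :
    ContDiffAt ℝ ∞ (affineMap s i) y :=
  ContDiffAt.ambientMap (contDiffAt_pi.2 fun k => (CP.contDiff_homog i k).contDiffAt) hy s

/-- Every vector with nonzero tail is, up to a factor, obtained from `(r, 1, 0)` by a rotation. -/
lemma exists_rotTail_eq {u : Fin 3 → ℂ} (hu : normSqTail u ≠ 0) :
    ∃ (r : ℝ) (c α β : ℂ), c ≠ 0 ∧ Complex.normSq α + Complex.normSq β = 1 ∧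
      rotTail α β ![(r : ℂ), 1, 0] = fun k => c * u k := by
  obtain ⟨e, he, heu⟩ := Complex.exists_norm_eq_mul_self (u 0)
  have hN : 0 < normSqTail u := (normSqTail_nonneg u).lt_of_ne' hu
  have hsq := Real.sq_sqrt hN.le
  have hs := Real.sqrt_pos.2 hN
  set n := √(normSqTail u)
  have he0 : e ≠ 0 := norm_ne_zero_iff.1 (he ▸ one_ne_zero)
  have hn0 : (n : ℂ) ≠ 0 := Complex.ofReal_ne_zero.2 hs.ne'
  have he2 : Complex.normSq e = 1 := by rw [Complex.normSq_eq_norm_sq, he, one_pow]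
  -- Rescaling by e/n makes the first coordinate real and the tail a unit vector (α, β), which is
  -- the image of (1, 0) under the rotation with these parameters.
  refine ⟨‖u 0‖ / n, e / n, e / n * u 1, e / n * u 2, div_ne_zero he0 hn0, ?_, ?_⟩
  · rw [Complex.normSq_mul, Complex.normSq_mul, ← mul_add, Complex.normSq_div, he2,
      Complex.normSq_ofReal, ← pow_two, hsq]
    exact one_div_mul_cancel hu
  · ext k
    fin_cases k
    · simp [rotTail, heu]
      ring
    · simp [rotTail]
    · simp [rotTail]

/-- Affine coordinates of the rotation of `[z : 1 : w]`. -/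
def affineRot (i : Fin 3) (α β : ℂ) (x : ℂ × ℂ) : ModelC2 :=
  WithLp.toLp 2 fun k =>
    rotTail α β ![x.1, 1, x.2] (i.succAbove k) / rotTail α β ![x.1, 1, x.2] i

lemma contDiff_rotTail (α β : ℂ) (k : Fin 3) :
    ContDiff ℝ ∞ fun x : ℂ × ℂ => rotTail α β ![x.1, 1, x.2] k := by
  fin_cases k <;> simp [rotTail] <;> fun_prop

lemma contDiffAt_affineRot {i : Fin 3} {α β : ℂ} {x : ℂ × ℂ}
    (hx : rotTail α β ![x.1, 1, x.2] i ≠ 0) : ContDiffAt ℝ ∞ (affineRot i α β) x := by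
  refine contDiffAt_piLp _ |>.2 fun k => ?_
  simp only [affineRot, div_eq_mul_inv]
  exact (contDiff_rotTail α β _).contDiffAt.mul ((contDiff_rotTail α β i).contDiffAt.inv hx)

lemma homog_affineRot {i : Fin 3} {α β : ℂ} {x : ℂ × ℂ} (hx : rotTail α β ![x.1, 1, x.2] i ≠ 0) :
    CP.homog i (affineRot i α β x) =
      fun k => (rotTail α β ![x.1, 1, x.2] i)⁻¹ * rotTail α β ![x.1, 1, x.2] k := by
  funext k
  induction k using Fin.succAboveCases i with
  | x => rw [CP.homog_self, inv_mul_cancel₀ hx]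
  | p k =>
    rw [CP.homog_succAbove]
    exact div_eq_inv_mul _ _

lemma affineMap_affineRot (s : ℝ) {i : Fin 3} {α β : ℂ}
    (h : Complex.normSq α + Complex.normSq β = 1) {x : ℂ × ℂ}
    (hx : rotTail α β ![x.1, 1, x.2] i ≠ 0) :
    affineMap s i (affineRot i α β x) = ambientRot s α β (modelMap x) := by
  rw [affineMap, homog_affineRot hx, ambientMap_smul s (inv_ne_zero hx), modelMap,
    ambientRot_ambientMap s h]

lemma isInvertible_of_injective {E E' : Type*} [NormedAddCommGroup E] [NormedSpace ℝ E]
    [NormedAddCommGroup E'] [NormedSpace ℝ E'] [FiniteDimensional ℝ E] [FiniteDimensional ℝ E']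
    {A : E →L[ℝ] E'} (hA : Function.Injective A)
    (hdim : Module.finrank ℝ E = Module.finrank ℝ E') : A.IsInvertible :=
  ⟨(LinearEquiv.ofInjectiveOfFinrankEq (A : E →ₗ[ℝ] E') hA hdim).toContinuousLinearEquiv, by
    ext; rfl⟩

lemma finrank_modelC2 : Module.finrank ℝ ModelC2 = 4 := by
  have h := Module.finrank_mul_finrank ℝ ℂ ModelC2
  rw [Complex.finrank_real_complex, finrank_euclideanSpace_fin] at h
  exact h.symm

lemma finrank_complex_prod : Module.finrank ℝ (ℂ × ℂ) = 4 := by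
  rw [Module.finrank_prod, Complex.finrank_real_complex]

/-- Near x, `affineMap` ∘ `affineRot` is `modelMap` followed by a linear map preserving
`ambientForm`; the identity follows by differentiating. -/
lemma affine_pullback {s : ℝ} (hs : s ^ 2 = 1) {i : Fin 3} {α β : ℂ}
    (h : Complex.normSq α + Complex.normSq β = 1) {x : ℂ × ℂ}
    (hx : rotTail α β ![x.1, 1, x.2] i ≠ 0) (a b : ℂ × ℂ) :
    modelMetric x a b = pullbackForm ambientForm (affineMap s i) (affineRot i α β x)
      (fderiv ℝ (affineRot i α β) x a) (fderiv ℝ (affineRot i α β) x b) := by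
  have htail : normSqTail (CP.homog i (affineRot i α β x)) ≠ 0 := by
    have : normSqTail (rotTail α β ![x.1, 1, x.2]) ≠ 0 := by
      rw [normSqTail_rotTail h, normSqTail_model]
      exact (one_add_normSq_pos _).ne'
    have hsm : normSqTail (CP.homog i (affineRot i α β x)) =
        Complex.normSq (rotTail α β ![x.1, 1, x.2] i)⁻¹ *
          normSqTail (rotTail α β ![x.1, 1, x.2]) := by
      rw [homog_affineRot hx]
      simp only [normSqTail, Complex.normSq_mul]
      ring
    rw [hsm]
    exact mul_ne_zero (by simpa using hx) this
  have h1 := ((contDiffAt_affineMap s htail).differentiableAt (by simp)).hasFDerivAt.comp x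
    ((contDiffAt_affineRot hx).differentiableAt (by simp)).hasFDerivAt
  have h2 := (ambientRot s α β).hasFDerivAt.comp x
    (contDiff_modelMap.differentiable (by simp) x).hasFDerivAt
  have hev : affineMap s i ∘ affineRot i α β =ᶠ[𝓝 x] ambientRot s α β ∘ modelMap := by
    filter_upwards [(contDiff_rotTail α β i).continuous.continuousAt.eventually_ne hx] with z hz
    exact affineMap_affineRot s h hz
  have h3 := h1.unique (h2.congr_of_eventuallyEq hev)
  have h4 : ∀ a, fderiv ℝ (affineMap s i) (affineRot i α β x) (fderiv ℝ (affineRot i α β) x a) =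
      ambientRot s α β (fderiv ℝ modelMap x a) := fun a => DFunLike.congr_fun h3 a
  refine Eq.symm ((pullbackForm_apply _ _ _ _ _).trans ?_)
  rw [h4, h4, affineMap_affineRot s h hx, ambientForm_rot h hs]
  rfl

/-- Transport from (r, 0) to y by `affineRot`. Agreement of G with the pullback only near y is
allowed, because the metric of the manifold in a chart is controlled only on the chart target. -/
theorem pos_and_posBiorthAt_affineMap {s : ℝ} (hs : s ^ 2 = 1) {i : Fin 3} {y : ModelC2}
    (hy : normSqTail (CP.homog i y) ≠ 0) :
    (∀ u ≠ 0, 0 < pullbackForm ambientForm (affineMap s i) y u u) ∧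
      ∀ G : ModelC2 → ModelC2 →L[ℝ] ModelC2 →L[ℝ] ℝ,
        G =ᶠ[𝓝 y] pullbackForm ambientForm (affineMap s i) → PosBiorthAt G y := by
  obtain ⟨r, c, α, β, hc, h, hrot⟩ := exists_rotTail_eq hy
  have hx : rotTail α β ![(r : ℂ), 1, 0] i ≠ 0 := by
    rw [hrot]
    simpa using hc
  have hxy : affineRot i α β ((r : ℂ), 0) = y := by
    ext k
    simp [affineRot, hrot, hc]
  have hpull := affine_pullback hs h (x := ((r : ℂ), 0)) hx
  have hinv : (fderiv ℝ (affineRot i α β) ((r : ℂ), 0)).IsInvertible := by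
    refine isInvertible_of_injective ((injective_iff_map_eq_zero _).2 fun a ha => ?_)
      (finrank_complex_prod.trans finrank_modelC2.symm)
    -- A kernel vector would have length zero for the positive definite model metric; bijectivity
    -- then follows from equality of dimensions.
    by_contra ha0
    have := modelMetric_pos ((r : ℂ), 0) a ha0
    rw [hpull, ha] at this
    simp at this
  have hpos : ∀ u ≠ 0, 0 < pullbackForm ambientForm (affineMap s i) y u u := by
    intro u hu
    obtain ⟨a, rfl⟩ := hinv.surjective u
    have := modelMetric_pos ((r : ℂ), 0) a fun ha => hu (by rw [ha, map_zero])
    rwa [hpull, hxy] at this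
  refine ⟨hpos, fun G hG => ?_⟩
  have hiso : IsLocalIsometryAt modelMetric G (affineRot i α β) ((r : ℂ), 0) := by
    refine ⟨contDiffAt_infty.1 (contDiffAt_affineRot hx) 3, hinv,
      isLocalMetricAt_modelMetric _, ⟨?_, ?_, ?_⟩, ?_⟩
    · rw [hxy]
      exact (ContDiffAt.pullbackForm (contDiff_infty.1 contDiff_ambientForm 2)
        (contDiffAt_infty.1 (contDiffAt_affineMap s hy) 3) (by norm_num)).congr_of_eventuallyEq hG
    · rw [hxy]
      filter_upwards [hG] with z hz a b
      rw [hz]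
      exact ambientForm_symm _ _ _
    · rw [hxy, hG.self_of_nhds]
      exact isInvertible_of_pos hpos
    · have hcont : ContinuousAt (affineRot i α β) ((r : ℂ), 0) :=
        (contDiffAt_affineRot hx).continuousAt
      rw [ContinuousAt, hxy] at hcont
      filter_upwards [(contDiff_rotTail α β i).continuous.continuousAt.eventually_ne hx,
        hcont.eventually hG] with z hz hz' a b
      rw [hz']
      exact affine_pullback hs h hz a b
  exact hxy ▸ (posBiorthAt_modelMetric r).map hiso

end AffineCoordinates

/-! ### The map from `ℂP² # -ℂP²` to the ambient space -/

section GlobalMap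

lemma ambientMap_rep_mk (s : ℝ) {u : Fin 3 → ℂ} (hu : u ≠ 0) :
    ambientMap s (CP.mk u hu).rep = ambientMap s u := by
  obtain ⟨a, ha, h⟩ := CP.exists_rep_mk u hu
  rw [funext h, ambientMap_smul s ha]

lemma normSqTail_homog_zero (v : ModelC2) : normSqTail (CP.homog 0 v) = ‖v‖ ^ 2 := by
  rw [EuclideanSpace.norm_sq_eq, Fin.sum_univ_two, normSqTail, Complex.normSq_eq_norm_sq,
    Complex.normSq_eq_norm_sq]
  rfl

lemma homog_zero_succ (v : ModelC2) (k : Fin 2) : CP.homog 0 v k.succ = v k :=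
  CP.homog_succAbove 0 v k

/-- The inversion keeps the vector v/(1 + |v|²), up to no change of the line through v, and replaces
|v|² by its inverse. This reverses the height, which the sign -1 compensates, so the maps on the two
summands agree on glued points. -/
lemma ambientMap_inversion {v : ModelC2} (hv : v ≠ 0) :
    ambientMap (-1) (CP.homog 0 (inversion v)) = ambientMap 1 (CP.homog 0 v) := by
  have hN : (‖v‖ ^ 2 : ℝ) ≠ 0 := pow_ne_zero 2 (norm_ne_zero_iff.2 hv)
  have hN' : normSqTail (CP.homog 0 (inversion v)) = (‖v‖ ^ 2)⁻¹ := by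
    rw [normSqTail_homog_zero, inversion, norm_smul, mul_pow, norm_inv, norm_pow, norm_norm]
    field_simp
  have hk : ∀ k, inversion v k = (‖v‖ ^ 2)⁻¹ • v k := fun _ => rfl
  have h1 : 1 + ‖v‖ ^ 2 ≠ 0 := by positivity
  have h2 : ‖v‖ ^ 2 + 1 ≠ 0 := by positivity
  simp only [ambientMap, hN', normSqTail_homog_zero, homog_zero_succ, CP.homog_self, map_one, hk]
  generalize ‖v‖ ^ 2 = N at *
  refine Prod.ext ?_ (Prod.ext ?_ ?_)
  · ext j
    simp only [one_mul, smul_smul]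
    congr 1
    field_simp
    ring
  · simp only
    field_simp
    ring
  · ext k
    simp only [Complex.real_smul, map_mul, Complex.conj_ofReal, inv_inv]
    have : (N : ℂ) ≠ 0 := Complex.ofReal_ne_zero.2 hN
    push_cast
    field_simp

/-- The map from `ℂP² # -ℂP²` to the ambient space. -/
def globalMap : CP2SumCP2Bar → Ambient :=
  Quotient.lift (s := glueSetoid CP.standardDisk CP.standardDisk)
    (Sum.elim (fun x => ambientMap 1 x.1.rep) (fun y => ambientMap (-1) y.1.rep)) <| by
    have key : ∀ {x y : CP.standardDisk.punctured}, Glued CP.standardDisk CP.standardDisk x y →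
        ambientMap 1 x.1.rep = ambientMap (-1) y.1.rep := by
      rintro x y ⟨v, hv, hx, hy⟩
      rw [hx, hy]
      change ambientMap 1 (CP.mk (CP.homog 0 v) _).rep =
        ambientMap (-1) (CP.mk (CP.homog 0 (inversion v)) _).rep
      rw [ambientMap_rep_mk, ambientMap_rep_mk, ambientMap_inversion hv]
    rintro (x | y) (x' | y') h
    · exact congrArg (fun x : CP.standardDisk.punctured => ambientMap 1 x.1.rep) h
    · exact key h
    · exact (key h).symm
    · exact congrArg (fun x : CP.standardDisk.punctured => ambientMap (-1) x.1.rep) h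

/-- The tail vanishes only at [1 : 0 : 0], the center of the standard disk, which has been removed.
-/
lemma normSqTail_ne_zero_of_mem_punctured {i : Fin 3} {y : ModelC2}
    (h : CP.mk (CP.homog i y) (CP.homog_ne_zero i y) ∈ CP.standardDisk.punctured) :
    normSqTail (CP.homog i y) ≠ 0 := by
  intro h0
  obtain ⟨h1, h2⟩ := (add_eq_zero_iff_of_nonneg (Complex.normSq_nonneg _)
    (Complex.normSq_nonneg _)).1 h0
  rw [Complex.normSq_eq_zero] at h1 h2
  refine h (CP.mk_eq_mk_of _ (CP.homog_ne_zero 0 (0 : ModelC2)) (CP.homog i y 0) fun k => ?_)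
  fin_cases k
  · exact (congrArg _ (CP.homog_self 0 0)).trans (mul_one _)
  · exact ((congrArg _ (homog_zero_succ 0 0)).trans (mul_zero _)).trans h1.symm
  · exact ((congrArg _ (homog_zero_succ 0 1)).trans (mul_zero _)).trans h2.symm

lemma exists_punctured_chart {e : OpenPartialHomeomorph CP.standardDisk.punctured ModelC2}
    (he : e ∈ atlas ModelC2 CP.standardDisk.punctured) : ∃ i : Fin 3, ∀ y ∈ e.target,
      (e.symm y : CP 2) = CP.mk (CP.homog i y) (CP.homog_ne_zero i y) := by
  obtain ⟨x, rfl⟩ := Set.mem_iUnion.1 he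
  obtain ⟨i, hi⟩ := CP.mem_atlas_iff.1 (chart_mem_atlas ModelC2 (x : CP 2))
  refine ⟨i, fun y hy => ?_⟩
  have h := (chartAt ModelC2 (x : CP 2)).subtypeRestr_symm_eqOn ⟨x⟩ hy
  refine h.symm.trans ?_
  rw [hi]
  rfl

/-- Each chart of the connected sum is a restricted affine chart of one summand: i is the index of
the affine chart, and s = 1 or -1 tells the summand. -/
lemma globalMap_chart (p : CP2SumCP2Bar) : ∃ (s : ℝ) (i : Fin 3), s ^ 2 = 1 ∧
    ∀ y ∈ (chartAt ModelC2 p).target, normSqTail (CP.homog i y) ≠ 0 ∧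
      (globalMap ∘ (chartAt ModelC2 p).symm) y = affineMap s i y := by
  obtain ⟨e, he, h⟩ | ⟨e, he, h⟩ := chart_mem_atlas ModelC2 p
  · obtain ⟨i, hi⟩ := exists_punctured_chart he
    refine ⟨1, i, one_pow 2, fun y hy => ?_⟩
    rw [← h] at hy ⊢
    refine ⟨normSqTail_ne_zero_of_mem_punctured (hi y hy ▸ (e.symm y).2), ?_⟩
    change ambientMap 1 (e.symm y : CP 2).rep = _
    rw [hi y hy, ambientMap_rep_mk, affineMap]
  · obtain ⟨i, hi⟩ := exists_punctured_chart he
    refine ⟨-1, i, by norm_num, fun y hy => ?_⟩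
    rw [← h] at hy ⊢
    refine ⟨normSqTail_ne_zero_of_mem_punctured (hi y hy ▸ (e.symm y).2), ?_⟩
    change ambientMap (-1) (e.symm y : CP 2).rep = _
    rw [hi y hy, ambientMap_rep_mk, affineMap]

lemma contMDiff_globalMap : ContMDiff 𝓘(ℝ, ModelC2) 𝓘(ℝ, Ambient) ∞ globalMap := by
  intro p
  obtain ⟨s, i, -, h⟩ := globalMap_chart p
  have h1 : ContDiffAt ℝ ∞ (globalMap ∘ (chartAt ModelC2 p).symm) (chartAt ModelC2 p p) :=
    (contDiffAt_affineMap s (h _ (mem_chart_target _ p)).1).congr_of_eventuallyEq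
      (Filter.eventuallyEq_of_mem ((chartAt ModelC2 p).open_target.mem_nhds
        (mem_chart_target _ p)) fun y hy => (h y hy).2)
  refine (h1.contMDiffAt.comp p ((contMDiffOn_chart (I := 𝓘(ℝ, ModelC2)) (n := ∞)).contMDiffAt
    ((chartAt ModelC2 p).open_source.mem_nhds (mem_chart_source _ p)))).congr_of_eventuallyEq ?_
  filter_upwards [(chartAt ModelC2 p).open_source.mem_nhds (mem_chart_source _ p)] with q hq
  simp [(chartAt ModelC2 p).left_inv hq]

lemma pullbackForm_globalMap (p : CP2SumCP2Bar) : ∃ (s : ℝ) (i : Fin 3), s ^ 2 = 1 ∧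
    normSqTail (CP.homog i (chartAt ModelC2 p p)) ≠ 0 ∧
    pullbackForm ambientForm (globalMap ∘ (chartAt ModelC2 p).symm)
      =ᶠ[𝓝 (chartAt ModelC2 p p)] pullbackForm ambientForm (affineMap s i) := by
  obtain ⟨s, i, hs, h⟩ := globalMap_chart p
  refine ⟨s, i, hs, (h _ (mem_chart_target _ p)).1, ?_⟩
  filter_upwards [(Filter.eventuallyEq_of_mem ((chartAt ModelC2 p).open_target.mem_nhds
    (mem_chart_target _ p)) fun y hy => (h y hy).2).eventuallyEq_nhds] with y hy
  rw [pullbackForm, pullbackForm, hy.self_of_nhds, hy.fderiv_eq]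

lemma pullbackForm_globalMap_pos (p : CP2SumCP2Bar) (u : ModelC2) (hu : u ≠ 0) :
    0 < pullbackForm ambientForm (globalMap ∘ (chartAt ModelC2 p).symm) (chartAt ModelC2 p p)
      u u := by
  obtain ⟨s, i, hs, hy, h⟩ := pullbackForm_globalMap p
  rw [h.self_of_nhds]
  exact (pos_and_posBiorthAt_affineMap hs hy).1 u hu

end GlobalMap

theorem mainTheorem2 :
    ∃ g : SmoothMetric ModelC2 CP2SumCP2Bar, g.PositiveBiorthogonalCurvature := by
  refine ⟨pullbackMetric contMDiff_globalMap contDiff_ambientForm ambientForm_symm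
    pullbackForm_globalMap_pos,
    SmoothMetric.positiveBiorthogonalCurvature_of_chart _ finrank_modelC2 fun p => ?_⟩
  obtain ⟨s, i, hs, hy, h⟩ := pullbackForm_globalMap p
  refine (pos_and_posBiorthAt_affineMap hs hy).2 _ (Filter.EventuallyEq.trans ?_ h)
  filter_upwards [(chartAt ModelC2 p).open_target.mem_nhds (mem_chart_target _ p)] with y hy'
  exact pullbackMetric_inChart _ _ _ _ p hy'

end
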